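/- For a word $w$ over an alphabet $\Sigma$ and $k\ge 0$, call $w$ $k$-universal (with respect to $\Sigma$) if the set of subsequences (scattered factors) of $w$ of length $k$ is $\Sigma^k$, and let $\iota(w)$ be the largest $k$ such that $w$ is $k$-universal. The computational model is the unit-cost word RAM with logarithmic word size: on inputs with main parameter $n$, a memory word holds $O(\log n)$ bits, arithmetic and bitwise operations on memory words take one time unit, and larger numbers are stored (and read and written) in blocks of about $\log_2 n$ bits, one block per memory word. Theorem. Let $w$ be a nonempty word with $|w|=n$, $\mathrm{alph}(w)=\Sigma$ and $\Sigma=\{1,2,\ldots,\sigma\}$, and let $k\ge\iota(w)$ be an integer. There is an algorithm (one program for all $w$, $\sigma$ and $k$) that, given $n$, $\sigma$, $w$ and $k$, computes the minimal number of insertions of single letters that need to be applied to $w$ in order to obtain a $k$-universal word (with respect to $\Sigma$), in time $O(nk)$ if $k\le n$, and in time $O(n^2+T(n,\sigma,k))$ if $k>n$, where $T(n,\sigma,k)$ is the time needed to compute $(k-n)\sigma$ from $n$, $\sigma$ and $k$ in the same model, i.e. the bound holds for every function $T$ such that some program computes $(k-n)\sigma$ in time at most $T(n,\sigma,k)$ for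 all $1\le\sigma\le n<k$. The constants hidden in the $O$-notation are absolute. -/

import Mathlib

/-! ## Words, universality, insertions -/

namespace Words

variable {α : Type*}

/-- The `k`-spectrum of `w`: the set of its subsequences (scattered factors) of length `k`. -/
def kSpectrum (k : ℕ) (w : List α) : Set (List α) :=
  {v | v.Sublist w ∧ v.length = k}

/-- `w` is `k`-universal with respect to the alphabet `α`:
its subsequences of length `k` are exactly all the words of length `k` over `α`. -/
def IsUniversal (k : ℕ) (w : List α) : Prop :=
  kSpectrum k w = {v | v.length = k}

/-- The universality index of `w`: the largest `k` such that `w` is `k`-universal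
(for a nonempty alphabet, the set below contains `0` and is bounded by `w.length`). -/
noncomputable def universalityIndex (w : List α) : ℕ :=
  sSup {k | IsUniversal k w}

/-- `InsertsTo m u v`: the word `v` results from `u` by `m` successive insertions of one letter. -/
inductive InsertsTo : ℕ → List α → List α → Prop
  | refl (u : List α) : InsertsTo 0 u u
  | insert {m : ℕ} {u : List α} (x : List α) (a : α) (y : List α)
      (h : InsertsTo m u (x ++ y)) : InsertsTo (m + 1) u (x ++ a :: y)

/-- `m` is the minimal number of insertions that turn `w` into a `k`-universal word. -/
def IsMinInsertions (k : ℕ) (w : List α) (m : ℕ) : Prop :=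
  IsLeast {j | ∃ v, InsertsTo j w v ∧ IsUniversal k v} m

end Words

/-! ## The unit-cost word RAM

A memory word holds `W` bits. The memory is an array of words, all zero at the start, that is
accessed directly (at addresses written in the program) or indirectly (at an address held in a
memory word). The input is read word by word from an input tape, the output is appended word by
word to an output tape. Every instruction costs one time unit. -/

namespace WordRAM

/-- Binary operations on words; subtraction is truncated at `0`, and `x / 0 = 0`, `x mod 0 = x`. -/
inductive Op
  | add | sub | mul | div | mod | and | or | xor | shl | shr

/-- The value of an operation, before it is cut down to the word size. -/
def Op.eval : Op → ℕ → ℕ → ℕ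
  | .add, x, y => x + y
  | .sub, x, y => x - y
  | .mul, x, y => x * y
  | .div, x, y => x / y
  | .mod, x, y => x % y
  | .and, x, y => x &&& y
  | .or, x, y => x ||| y
  | .xor, x, y => x ^^^ y
  | .shl, x, y => x <<< y
  | .shr, x, y => x >>> y

/-- Instructions; `M` is the memory and `t` a position in the program. -/
inductive Instr
  /-- `M[d] := v` -/
  | const (d v : ℕ)
  /-- `M[d] := M[a] o M[b]` -/
  | op (o : Op) (d a b : ℕ)
  /-- `M[d] := M[M[a]]` -/
  | load (d a : ℕ)
  /-- `M[M[a]] := M[s]` -/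
  | store (a s : ℕ)
  /-- go to `t` if `M[a] < M[b]` -/
  | jlt (a b t : ℕ)
  /-- go to `t` if `M[a] = M[b]` -/
  | jeq (a b t : ℕ)
  /-- move the next word of the input tape to `M[d]`; go to `t` if the tape is used up -/
  | read (d t : ℕ)
  /-- append `M[s]` to the output tape -/
  | write (s : ℕ)

/-- A program is a finite sequence of instructions. -/
abbrev Program := List Instr

/-- A configuration: program counter, memory, unread part of the input tape, output tape. -/
structure Config where
  pc : ℕ
  mem : ℕ → ℕ
  inp : List ℕ
  out : List ℕ

/-- The initial configuration on a given input tape. -/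
def Config.start (input : List ℕ) : Config := ⟨0, fun _ => 0, input, []⟩

/-- Store a value, cut down to `W` bits, at an address, and go on to the next instruction. -/
def Config.set (W : ℕ) (s : Config) (d v : ℕ) : Config :=
  { s with pc := s.pc + 1, mem := Function.update s.mem d (v % 2 ^ W) }

/-- Go to `t` if `p` holds, and to the next instruction otherwise. -/
def Config.jump (s : Config) (p : Prop) [Decidable p] (t : ℕ) : Config :=
  { s with pc := if p then t else s.pc + 1 }

/-- The effect of one instruction with words of `W` bits. -/
def Instr.exec (W : ℕ) (s : Config) : Instr → Config
  | .const d v => s.set W d v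
  | .op o d a b => s.set W d (o.eval (s.mem a) (s.mem b))
  | .load d a => s.set W d (s.mem (s.mem a))
  | .store a r => s.set W (s.mem a) (s.mem r)
  | .jlt a b t => s.jump (s.mem a < s.mem b) t
  | .jeq a b t => s.jump (s.mem a = s.mem b) t
  | .read d t =>
      match s.inp with
      | [] => { s with pc := t }
      | x :: rest => { s.set W d x with inp := rest }
  | .write r => { s with pc := s.pc + 1, out := s.out ++ [s.mem r] }

/-- The machine has halted once the program counter has left the program. -/
def Halted (P : Program) (s : Config) : Prop := P.length ≤ s.pc

/-- One time step; a halted configuration does not change any more. -/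
def step (P : Program) (W : ℕ) (s : Config) : Config :=
  match P[s.pc]? with
  | none => s
  | some i => i.exec W s

/-- With words of `W` bits and on the given input tape, `P` halts after at most `t` steps with
the given output tape. -/
def HaltsWithin (P : Program) (W : ℕ) (input : List ℕ) (t : ℕ) (output : List ℕ) : Prop :=
  Halted P ((step P W)^[t] (Config.start input)) ∧
    ((step P W)^[t] (Config.start input)).out = output

/-- Logarithmic word size: `c * ⌈log₂ (n + 1)⌉` bits, for a constant `c`. -/
def wordBits (c n : ℕ) : ℕ := c * Nat.size n

/-- Large numbers are written in blocks of `⌈log₂ (n + 1)⌉` bits, one block per word, that is, in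
base `limbBase n`, the least power of two that exceeds `n`. -/
def limbBase (n : ℕ) : ℕ := 2 ^ Nat.size n

/-- `P`, run with words of `wordBits c n` bits on the given input tape, halts after at most `t`
steps and has then written the number `v` on the output tape (least significant block first). -/
def ComputesWithin (P : Program) (c n : ℕ) (input : List ℕ) (v t : ℕ) : Prop :=
  ∃ output : List ℕ, HaltsWithin P (wordBits c n) input t output ∧
    (∀ x ∈ output, x < limbBase n) ∧ Nat.ofDigits (limbBase n) output = v

/-- The input tape for the word `w` over `{1, …, σ}` and the number `k`: the length `n` of `w`,
the size `σ` of the alphabet, the letters of `w`, the blocks of `k` (least significant first). -/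
def wordInput {σ : ℕ} (w : List (Fin σ)) (k : ℕ) : List ℕ :=
  w.length :: σ :: (w.map (fun a => (a : ℕ) + 1) ++ Nat.digits (limbBase w.length) k)

/-- The input tape for the numbers `n`, `σ` and `k`. -/
def numInput (n σ k : ℕ) : List ℕ :=
  n :: σ :: Nat.digits (limbBase n) k

/-- `(k - n) * σ` can be computed from `n`, `σ` and `k` in time `T n σ k` on a word RAM with
words of `O(log n)` bits, whenever `1 ≤ σ ≤ n < k`. -/
def ProductTime (T : ℕ → ℕ → ℕ → ℕ) : Prop :=
  ∃ (P : Program) (c : ℕ), ∀ n σ k : ℕ, 1 ≤ σ → σ ≤ n → n < k →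
    ComputesWithin P c n (numInput n σ k) ((k - n) * σ) (T n σ k)

end WordRAM

/-! A word is `k`-universal exactly when it splits into `k` factors (arches), each containing every
letter. If `v` arises from `w` by insertions, the arches of `v` cut `w` into `k` factors, possibly
empty. A factor with `d` distinct letters needs at least `σ - d` inserted letters, and appending the
missing ones attains this. Hence the minimum is `kσ - F`, where `F` is the largest total number of
distinct letters over all factorizations of `w` into `k` factors
(`isMinInsertions_of_factorizations`). For `k ≥ n`, cutting into single letters gives `F = n`. For
`k ≤ n`, `F = bestSum w k n` comes from a recursion on the last factor.

A layer `t → t + 1` of this recursion has to cost `O(n)`. For a fixed end `j`, the map sending `i`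
to the maximum of `bestSum w t i' + distinct w i' j` over `i ≤ i' ≤ j` is nonincreasing and drops by
at most one at a time, so a set `D` of drop positions (tokens) and the value at `i = j` determine
it. Appending a letter whose previous occurrence is `p` raises exactly the candidates `i' ≥ p` by
one; on the tokens this erases the largest token `≤ p`. The growth of `bestSum w t` decides whether
`j + 1` is a token. Whether a token was used up tells whether `bestSum w (t + 1)` grows
(`TokenInv.step`), so one bit per position passes from layer to layer.

The tokens thus need deletion and predecessor search only. They are stored in about `n / log n`
blocks of about `log n` bits; a table of leading bits answers queries inside a block. The blocks are
grouped into intervals starting at nonempty blocks. A block that becomes empty is merged to the left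
by relabelling the shorter interval. Each relabelled block at least doubles the length of its
interval, so a layer relabels only `O(n)` times.

The algorithm is written in a structured language whose semantics counts machine instructions
exactly; `Exec.simulate` transfers it to the word RAM. For `k > n` only `kσ - n` has to be written,
in time linear in `n` plus the number of digits of `k`; any program for `(k - n)σ` writes enough
blocks to pay for these digits. -/

namespace Words

/-! ### Insertions and subsequences -/

variable {α : Type*}

theorem isUniversal_iff {k : ℕ} {w : List α} :
    IsUniversal k w ↔ ∀ x : List α, x.length = k → x.Sublist w := by
  constructor
  · intro h x hx
    have : x ∈ kSpectrum k w := by rw [h]; exact hx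
    exact this.1
  · intro h
    ext x
    exact ⟨fun hx => hx.2, fun hx => ⟨h x hx, hx⟩⟩

theorem InsertsTo.cons {m : ℕ} {u v : List α} (a : α) (h : InsertsTo m u v) :
    InsertsTo m (a :: u) (a :: v) := by
  induction h with
  | refl u => exact .refl _
  | insert x b y _ ih => exact .insert (a :: x) b y ih

/-- Each letter of `v` that an embedding of `u` skips is one insertion, so the order of the
insertions is irrelevant. -/
theorem insertsTo_iff {m : ℕ} {u v : List α} :
    InsertsTo m u v ↔ u.Sublist v ∧ v.length = u.length + m := by
  constructor
  · intro h
    induction h with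
    | refl u => exact ⟨.refl _, rfl⟩
    | insert x a y _ ih =>
      refine ⟨ih.1.trans ((List.Sublist.refl x).append (List.sublist_cons_self a y)), ?_⟩
      have := ih.2
      simp only [List.length_append, List.length_cons] at this ⊢
      omega
  · rintro ⟨h, hl⟩
    induction h generalizing m with
    | slnil =>
      obtain rfl : m = 0 := by simpa using hl.symm
      exact .refl _
    | @cons l₁ l₂ a h ih =>
      have := h.length_le
      obtain ⟨m', rfl⟩ : ∃ m', m = m' + 1 := ⟨m - 1, by simp at hl; omega⟩
      exact .insert [] a l₂ (ih (by simp at hl; omega))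
    | cons_cons a _ ih => exact (ih (by simp at hl; omega)).cons a

/-! ### Arch factorizations and the cost of completing factors -/

section Arches

variable [DecidableEq α]

/-- The total number of distinct letters in the factors of a factorization. -/
def letterSum (L : List (List α)) : ℕ := (L.map fun u => u.toFinset.card).sum

@[simp] theorem letterSum_nil : letterSum ([] : List (List α)) = 0 := rfl

@[simp] theorem letterSum_cons (u : List α) (L : List (List α)) :
    letterSum (u :: L) = u.toFinset.card + letterSum L := by simp [letterSum]

@[simp] theorem letterSum_append (L L' : List (List α)) :
    letterSum (L ++ L') = letterSum L + letterSum L' := by simp [letterSum]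

theorem letterSum_le_length (L : List (List α)) : letterSum L ≤ L.flatten.length := by
  induction L with
  | nil => simp
  | cons u L ih =>
    have := u.toFinset_card_le
    simp only [letterSum_cons, List.flatten_cons, List.length_append]
    omega

variable [Fintype α]

theorem letterSum_le_mul (L : List (List α)) : letterSum L ≤ L.length * Fintype.card α := by
  induction L with
  | nil => simp
  | cons u L ih =>
    have := Finset.card_le_univ u.toFinset
    simp only [letterSum_cons, List.length_cons, add_mul]
    omega

omit [DecidableEq α] [Fintype α] in
-- The `i`-th letter of a given word can be taken from the `i`-th factor.
theorem isUniversal_flatten {L : List (List α)} (h : ∀ u ∈ L, ∀ a, a ∈ u) :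
    IsUniversal L.length L.flatten := by
  rw [isUniversal_iff]
  induction L with
  | nil => intro x hx; simp_all
  | cons u L ih =>
    intro x hx
    match x, hx with
    | a :: x, hx =>
      have h1 : [a].Sublist u := List.singleton_sublist.2 (h u (by simp) a)
      exact h1.append (ih (fun u hu => h u (by simp [hu])) x (by simpa using hx))

omit [DecidableEq α] [Fintype α] in
-- The first arch is the shortest prefix with all letters; by minimality its last letter is new.
theorem exists_first_arch [Nonempty α] {v : List α} (h : ∀ a, a ∈ v) :
    ∃ p a r, v = p ++ a :: r ∧ a ∉ p ∧ ∀ b, b ∈ p ++ [a] := by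
  classical
  have hex : ∃ m, ∀ a, a ∈ v.take m := ⟨v.length, by simpa using h⟩
  obtain ⟨m, hm⟩ : ∃ m, Nat.find hex = m + 1 := by
    refine Nat.exists_eq_succ_of_ne_zero fun h0 => ?_
    have := Nat.find_spec hex (Classical.arbitrary α)
    rw [h0] at this
    simp at this
  have hall := Nat.find_spec hex
  rw [hm] at hall
  have hnot : ¬ ∀ a, a ∈ v.take m := Nat.find_min hex (by omega)
  push Not at hnot
  obtain ⟨a, ha⟩ := hnot
  have hlt : m < v.length := by
    by_contra hc
    rw [List.take_of_length_le (by omega)] at ha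
    exact ha (h a)
  rw [List.take_succ_eq_append_getElem hlt] at hall
  have hav : v[m] = a := by
    have := hall a
    simp only [List.mem_append, List.mem_singleton] at this
    exact (this.resolve_left ha).symm
  rw [hav] at hall
  refine ⟨v.take m, a, v.drop (m + 1), ?_, ha, hall⟩
  rw [← hav, List.cons_getElem_drop_succ, List.take_append_drop]

omit [DecidableEq α] [Fintype α] in
-- Greedy splitting. The last letter `a` of the first arch does not occur earlier, so an embedding
-- of `a :: x` places `x` behind this arch, and the rest is `k`-universal. The last factor absorbs
-- whatever remains, which requires at least one factor.
theorem IsUniversal.exists_arches [Nonempty α] {k : ℕ} {v : List α} (h : IsUniversal (k + 1) v) :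
    ∃ L : List (List α), L.length = k + 1 ∧ L.flatten = v ∧ ∀ u ∈ L, ∀ a, a ∈ u := by
  rw [isUniversal_iff] at h
  have hmem (a : α) : a ∈ v :=
    (h (List.replicate (k + 1) a) (by simp)).subset (by simp)
  induction k generalizing v with
  | zero => exact ⟨[v], by simp, by simp, by simpa using hmem⟩
  | succ k ih =>
    obtain ⟨p, a, r, rfl, hap, hall⟩ := exists_first_arch hmem
    have hr (x : List α) (hx : x.length = k + 1) : x.Sublist r := by
      have h1 := h (a :: x) (by simp [hx])
      obtain ⟨l₁, l₂, h12, hl₁, hl₂⟩ := List.sublist_append_iff.1 h1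
      cases l₁ with
      | cons b l₁ =>
        simp only [List.cons_append, List.cons.injEq] at h12
        exact absurd (hl₁.subset (by simp [h12.1])) hap
      | nil =>
        rw [List.nil_append] at h12
        rw [← h12] at hl₂
        exact List.cons_sublist_cons.1 hl₂
    obtain ⟨L, hL, hf, hu⟩ := ih hr
      (fun a => (hr (List.replicate (k + 1) a) (by simp)).subset (by simp))
    refine ⟨(p ++ [a]) :: L, by simp [hL], by simp [hf], ?_⟩
    intro u hu'
    rcases List.mem_cons.1 hu' with rfl | hu'
    · exact hall
    · exact hu u hu'

omit [Fintype α] in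
-- Each inserted letter adds at most one new letter to the set of letters.
theorem card_toFinset_add_length_le {u v : List α} (h : u.Sublist v) :
    v.toFinset.card + u.length ≤ v.length + u.toFinset.card := by
  induction h with
  | slnil => simp
  | @cons l₁ l₂ a _ ih =>
    have := Finset.card_insert_le a l₂.toFinset
    simp only [List.toFinset_cons, List.length_cons]
    omega
  | @cons_cons l₁ l₂ a h ih =>
    simp only [List.toFinset_cons, List.length_cons]
    by_cases ha : a ∈ l₁
    · rw [Finset.insert_eq_of_mem (s := l₁.toFinset) (by simpa using ha),
        Finset.insert_eq_of_mem (s := l₂.toFinset) (by simpa using h.subset ha)]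
      omega
    · rw [Finset.card_insert_of_notMem (s := l₁.toFinset) (by simpa using ha)]
      have := Finset.card_insert_le a l₂.toFinset
      omega

/-- Lower bound: the embedding of `w` is cut along the arches, and each arch is charged separately
by `card_toFinset_add_length_le`. -/
theorem exists_factorization_of_sublist {L : List (List α)} (h : ∀ u ∈ L, ∀ a, a ∈ u)
    {w : List α} (hw : w.Sublist L.flatten) :
    ∃ L' : List (List α), L'.length = L.length ∧ L'.flatten = w ∧
      L.length * Fintype.card α + w.length ≤ L.flatten.length + letterSum L' := by
  induction L generalizing w with
  | nil => exact ⟨[], rfl, by simpa [eq_comm] using hw, by simp_all⟩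
  | cons u L ih =>
    rw [List.flatten_cons, List.sublist_append_iff] at hw
    obtain ⟨x, y, rfl, hx, hy⟩ := hw
    obtain ⟨L', h1, h2, h3⟩ := ih (fun u hu => h u (by simp [hu])) hy
    refine ⟨x :: L', by simp [h1], by simp [h2], ?_⟩
    have h4 := card_toFinset_add_length_le hx
    have h5 : u.toFinset = Finset.univ := by
      ext a; simp [h u (by simp) a]
    rw [h5, Finset.card_univ] at h4
    simp only [List.length_cons, List.flatten_cons, List.length_append, letterSum_cons, add_mul,
      one_mul]
    omega

/-- Upper bound: the letters missing from a factor are appended to it. -/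
theorem exists_arches_of_factorization (L : List (List α)) :
    ∃ L' : List (List α), L'.length = L.length ∧ L.flatten.Sublist L'.flatten ∧
      (∀ u ∈ L', ∀ a, a ∈ u) ∧
      L'.flatten.length + letterSum L = L.flatten.length + L.length * Fintype.card α := by
  induction L with
  | nil => exact ⟨[], by simp⟩
  | cons u L ih =>
    obtain ⟨L', h1, h2, h3, h4⟩ := ih
    refine ⟨(u ++ (Finset.univ \ u.toFinset).toList) :: L', by simp [h1], ?_, ?_, ?_⟩
    · simp only [List.flatten_cons]
      exact (List.sublist_append_left _ _).append h2
    · intro x hx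
      rcases List.mem_cons.1 hx with rfl | hx
      · intro a
        simp only [List.mem_append, Finset.mem_toList, Finset.mem_sdiff, Finset.mem_univ, true_and,
          List.mem_toFinset]
        exact em _
      · exact h3 x hx
    · have h5 : (Finset.univ \ u.toFinset).card + u.toFinset.card = Fintype.card α := by
        rw [Finset.card_sdiff_add_card_eq_card (Finset.subset_univ _), Finset.card_univ]
      simp only [List.flatten_cons, List.length_append, Finset.length_toList, letterSum_cons,
        List.length_cons, add_mul, one_mul]
      omega

/-- The minimal number of insertions in terms of the factorizations of `w` into `k` factors. -/
theorem isMinInsertions_of_factorizations [Nonempty α] {k F : ℕ} {w : List α} (hk : 0 < k)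
    (hle : ∀ L : List (List α), L.length = k → L.flatten = w → letterSum L ≤ F)
    (hex : ∃ L : List (List α), L.length = k ∧ L.flatten = w ∧ letterSum L = F) :
    IsMinInsertions k w (k * Fintype.card α - F) := by
  constructor
  · obtain ⟨L, hL, hf, hs⟩ := hex
    obtain ⟨L', h1, h2, h3, h4⟩ := exists_arches_of_factorization L
    have := letterSum_le_mul L
    refine ⟨L'.flatten, insertsTo_iff.2 ⟨hf ▸ h2, ?_⟩, ?_⟩
    · rw [hf, hL, hs] at h4
      rw [hL, hs] at this
      omega
    · have := isUniversal_flatten h3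
      rwa [h1, hL] at this
  · rintro j ⟨v, hv, hu⟩
    obtain ⟨k, rfl⟩ : ∃ k', k = k' + 1 := ⟨k - 1, by omega⟩
    obtain ⟨hs, hl⟩ := insertsTo_iff.1 hv
    obtain ⟨L, hL, rfl, hLu⟩ := hu.exists_arches
    obtain ⟨L', h1, h2, h3⟩ := exists_factorization_of_sublist hLu hs
    have := hle L' (h1.trans hL) h2
    rw [hL] at h3
    omega

/-- One factor per letter, padded with empty factors, meets the trivial bound `letterSum L ≤
w.length`. -/
theorem isMinInsertions_of_length_le [Nonempty α] {k : ℕ} {w : List α} (hk : 0 < k)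
    (h : w.length ≤ k) : IsMinInsertions k w (k * Fintype.card α - w.length) := by
  refine isMinInsertions_of_factorizations hk ?_
    ⟨w.map (fun a => [a]) ++ List.replicate (k - w.length) [], ?_, ?_, ?_⟩
  · rintro L - rfl
    exact letterSum_le_length L
  · simp; omega
  · simp [← List.flatMap_def]
  · rw [letterSum_append]
    simp [letterSum, Function.comp_def]

end Arches

/-- This excludes `k = 0`, where the formula by factorizations does not apply. Boundedness is needed
because `sSup` of an unbounded set of naturals is `0`. -/
theorem universalityIndex_pos {w : List α} [Nonempty α] (h : ∀ a, a ∈ w) :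
    0 < universalityIndex w := by
  have hb : BddAbove {k | IsUniversal k w} := by
    refine ⟨w.length, fun k hk => ?_⟩
    have := (isUniversal_iff.1 hk (List.replicate k (Classical.arbitrary α)) (by simp)).length_le
    simpa using this
  refine Nat.lt_of_lt_of_le Nat.zero_lt_one (le_csSup hb (isUniversal_iff.2 fun x hx => ?_))
  obtain ⟨a, rfl⟩ := List.length_eq_one_iff.1 hx
  exact List.singleton_sublist.2 (h a)

end Words

/-! ### The dynamic program over factorizations -/

namespace Words

variable {α : Type*} [DecidableEq α]

/-- The number of distinct letters at the positions `i + 1, …, j` of `w`. -/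
def distinct (w : List α) (i j : ℕ) : ℕ := ((w.take j).drop i).toFinset.card

/-- The maximal number of letters distinguished by `t` factors that cover the first `j` letters. -/
def bestSum (w : List α) : ℕ → ℕ → ℕ
  | 0, _ => 0
  | t + 1, j => (Finset.range (j + 1)).sup fun i => bestSum w t i + distinct w i j

/-- The last position (counted from `1`) of the letter `a` among the first `j` positions,
and `0` if there is none. -/
def lastOcc (w : List α) : ℕ → α → ℕ
  | 0, _ => 0
  | j + 1, a => if w[j]? = some a then j + 1 else lastOcc w j a

theorem lastOcc_le (w : List α) (j : ℕ) (a : α) : lastOcc w j a ≤ j := by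
  induction j with
  | zero => simp [lastOcc]
  | succ j ih => rw [lastOcc]; split_ifs <;> omega

omit [DecidableEq α] in
theorem drop_take_succ {w : List α} {i j : ℕ} (hij : i ≤ j) (hj : j < w.length) :
    (w.take (j + 1)).drop i = (w.take j).drop i ++ [w[j]] := by
  rw [List.take_succ_eq_append_getElem hj, List.drop_append_of_le_length (by simp; omega)]

theorem mem_drop_take_iff {w : List α} {i j : ℕ} (hij : i ≤ j) (hj : j ≤ w.length) (a : α) :
    a ∈ (w.take j).drop i ↔ i < lastOcc w j a := by
  induction j with
  | zero => simp [lastOcc]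
  | succ j ih =>
    rw [lastOcc, List.getElem?_eq_getElem (by omega)]
    rcases Nat.lt_or_ge j i with h | h
    · have := lastOcc_le w j a
      rw [List.drop_eq_nil_of_le (by simp; omega)]
      split_ifs <;> simp <;> omega
    · rw [drop_take_succ h (by omega), List.mem_append, ih h (by omega), List.mem_singleton]
      have := lastOcc_le w j a
      by_cases hw : a = w[j]
      · simp only [hw, if_true, or_true, true_iff]; omega
      · rw [if_neg (by simpa [eq_comm] using hw)]
        simp [hw]

theorem distinct_self (w : List α) (j : ℕ) : distinct w j j = 0 := by
  simp [distinct]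

/-- The appended letter is new in the factor exactly when its previous occurrence lies at or before
`i`; thus an extension affects a final segment of the starting points. -/
theorem distinct_succ {w : List α} {i j : ℕ} (hij : i ≤ j) (hj : j < w.length) :
    distinct w i (j + 1) = distinct w i j + if lastOcc w j w[j] ≤ i then 1 else 0 := by
  have h := mem_drop_take_iff hij hj.le w[j]
  rw [distinct, distinct, drop_take_succ hij hj, List.toFinset_append]
  simp only [List.toFinset_cons, List.toFinset_nil, insert_empty_eq]
  rw [Finset.union_comm, ← Finset.insert_eq]
  split_ifs with hl
  · rw [Finset.card_insert_of_notMem (by rw [List.mem_toFinset, h]; omega)]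
  · rw [Finset.insert_eq_of_mem (by rw [List.mem_toFinset, h]; omega), add_zero]

theorem bestSum_zero_right (w : List α) (t : ℕ) : bestSum w t 0 = 0 := by
  induction t with
  | zero => rfl
  | succ t ih => simp [bestSum, ih, distinct_self]

theorem letterSum_le_bestSum (w : List α) (t j : ℕ) (L : List (List α)) (hL : L.length = t)
    (hf : L.flatten = w.take j) (hj : j ≤ w.length) : letterSum L ≤ bestSum w t j := by
  induction t generalizing j L with
  | zero =>
    rw [List.length_eq_zero_iff] at hL
    simp [hL]
  | succ t ih =>
    have hne : L ≠ [] := fun h => by simp [h] at hL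
    obtain ⟨L', u, rfl⟩ : ∃ L' u, L = L' ++ [u] := 
      ⟨L.dropLast, L.getLast hne, (List.dropLast_append_getLast hne).symm⟩
    rw [List.flatten_append, List.flatten_singleton] at hf
    have hlen : L'.flatten.length ≤ j := by
      have := congrArg List.length hf
      rw [List.length_append, List.length_take] at this
      omega
    have h1 : L'.flatten = w.take L'.flatten.length := by
      have := congrArg (List.take L'.flatten.length) hf
      rwa [List.take_left, List.take_take, min_eq_left hlen] at this
    have h2 : u = (w.take j).drop L'.flatten.length := by
      rw [← hf, List.drop_left]
    have h3 := ih _ L' (by simpa using hL) h1 (by omega)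
    have h4 := Finset.le_sup (f := fun i => bestSum w t i + distinct w i j)
      (Finset.mem_range.2 (Nat.lt_succ_of_le hlen))
    rw [bestSum]
    refine le_trans ?_ h4
    rw [letterSum_append, letterSum_cons, letterSum_nil]
    simp only [distinct, ← h2]
    omega

/-- At least one factor is needed: `bestSum w 0` is `0` at every `j`, although zero factors cover
only the empty prefix. For one factor the best start is `0`, so this convention does no harm. -/
theorem exists_letterSum_ge_bestSum (w : List α) (t j : ℕ) (hj : j ≤ w.length) :
    ∃ L : List (List α), L.length = t + 1 ∧ L.flatten = w.take j ∧
      bestSum w (t + 1) j ≤ letterSum L := by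
  induction t generalizing j with
  | zero =>
    refine ⟨[w.take j], rfl, by simp, ?_⟩
    simp only [bestSum, letterSum_cons, letterSum_nil, add_zero, zero_add]
    refine Finset.sup_le fun i _ => Finset.card_le_card fun a ha => ?_
    rw [List.mem_toFinset] at ha ⊢
    exact List.mem_of_mem_drop ha
  | succ t ih =>
    obtain ⟨i, hi, he⟩ := Finset.exists_mem_eq_sup (Finset.range (j + 1)) (by simp)
      (fun i => bestSum w (t + 1) i + distinct w i j)
    rw [Finset.mem_range] at hi
    obtain ⟨L, h1, h2, h3⟩ := ih i (by omega)
    refine ⟨L ++ [(w.take j).drop i], by simp [h1], ?_, ?_⟩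
    · have : w.take i = (w.take j).take i := by rw [List.take_take, min_eq_left (by omega)]
      rw [List.flatten_append, h2, List.flatten_singleton, this, List.take_append_drop]
    · rw [bestSum, he]
      simp only [letterSum_append, letterSum_cons, letterSum_nil, distinct]
      omega

theorem isMinInsertions_bestSum [Fintype α] [Nonempty α] {k : ℕ} (hk : 0 < k) (w : List α) :
    IsMinInsertions k w (k * Fintype.card α - bestSum w k w.length) := by
  have hle (L : List (List α)) (hL : L.length = k) (hf : L.flatten = w) :
      letterSum L ≤ bestSum w k w.length :=
    letterSum_le_bestSum w k w.length L hL (by simpa using hf) le_rfl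
  refine isMinInsertions_of_factorizations hk hle ?_
  obtain ⟨k, rfl⟩ : ∃ k', k = k' + 1 := ⟨k - 1, by omega⟩
  obtain ⟨L, h1, h2, h3⟩ := exists_letterSum_ge_bestSum w k w.length le_rfl
  rw [List.take_length] at h2
  exact ⟨L, h1, h2, le_antisymm (hle L h1 h2) h3⟩

theorem bestSum_le_length [Fintype α] [Nonempty α] {k : ℕ} (hk : 0 < k) (w : List α) :
    bestSum w k w.length ≤ w.length := by
  obtain ⟨k, rfl⟩ : ∃ k', k = k' + 1 := ⟨k - 1, by omega⟩
  obtain ⟨L, h1, h2, h3⟩ := exists_letterSum_ge_bestSum w k w.length le_rfl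
  have := letterSum_le_length L
  rw [h2, List.take_length] at this
  omega

theorem bestSum_le_mul [Fintype α] [Nonempty α] {k : ℕ} (hk : 0 < k) (w : List α) :
    bestSum w k w.length ≤ k * Fintype.card α := by
  obtain ⟨k, rfl⟩ : ∃ k', k = k' + 1 := ⟨k - 1, by omega⟩
  obtain ⟨L, h1, h2, h3⟩ := exists_letterSum_ge_bestSum w k w.length le_rfl
  have := letterSum_le_mul L
  rw [h1] at this
  omega

/-! ### Tokens -/

/-- The number of elements of `D` among `i + 1, …, j`. -/
def tokens (D : Finset ℕ) (i j : ℕ) : ℕ := (D ∩ Finset.Ioc i j).card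

theorem tokens_self (D : Finset ℕ) (i : ℕ) : tokens D i i = 0 := by simp [tokens]

theorem tokens_succ (D : Finset ℕ) {i j : ℕ} (h : i ≤ j) :
    tokens D i (j + 1) = tokens D i j + if j + 1 ∈ D then 1 else 0 := by
  have h1 : Finset.Ioc i (j + 1) = insert (j + 1) (Finset.Ioc i j) := by
    ext x; simp only [Finset.mem_Ioc, Finset.mem_insert]; omega
  rw [tokens, tokens, h1]
  split_ifs with hD
  · rw [Finset.inter_insert_of_mem hD, Finset.card_insert_of_notMem (by simp)]
  · rw [Finset.inter_insert_of_notMem hD, add_zero]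

theorem tokens_erase (D : Finset ℕ) {x : ℕ} (hx : x ∈ D) (i j : ℕ) :
    tokens (D.erase x) i j + (if i < x ∧ x ≤ j then 1 else 0) = tokens D i j := by
  rw [tokens, tokens, Finset.erase_inter]
  split_ifs with h
  · rw [Finset.card_erase_add_one (by simp [hx, h])]
  · rw [Finset.erase_eq_of_notMem (by simp [h]), add_zero]

theorem tokens_anti (D : Finset ℕ) {i i' : ℕ} (h : i ≤ i') (j : ℕ) :
    tokens D i' j ≤ tokens D i j :=
  Finset.card_le_card (Finset.inter_subset_inter_left (Finset.Ioc_subset_Ioc_left h))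

theorem tokens_lt (D : Finset ℕ) {i i' j u : ℕ} (hu : u ∈ D) (h : i < u) (h' : u ≤ i')
    (hj : i' ≤ j) : tokens D i' j < tokens D i j := by
  refine Finset.card_lt_card ⟨Finset.inter_subset_inter_left
    (Finset.Ioc_subset_Ioc_left (by omega)), fun hs => ?_⟩
  have := @hs u (by simp [hu]; omega)
  simp only [Finset.mem_inter, Finset.mem_Ioc] at this
  omega

theorem tokens_eq (D : Finset ℕ) {i i' : ℕ} (h : ∀ x ∈ D, i < x → i' < x) (hi : i ≤ i') (j : ℕ) :
    tokens D i j = tokens D i' j := by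
  refine le_antisymm (Finset.card_le_card fun x hx => ?_) (tokens_anti D hi j)
  simp only [Finset.mem_inter, Finset.mem_Ioc] at hx ⊢
  exact ⟨hx.1, h x hx.1 hx.2.1, hx.2.2⟩

/-- The tokens `D` mark the places where, for the first `j` letters, the best value over the starting
points `≥ i` of the last of `t + 1` factors drops as `i` grows. -/
structure TokenInv (w : List α) (t j : ℕ) (D : Finset ℕ) : Prop where
  le : ∀ i i', i ≤ i' → i' ≤ j →
    bestSum w t i' + distinct w i' j ≤ bestSum w t j + tokens D i j
  ge : ∀ i, i ≤ j → ∃ i', i ≤ i' ∧ i' ≤ j ∧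
    bestSum w t j + tokens D i j ≤ bestSum w t i' + distinct w i' j

/-- Only positions up to `j` are ever counted, so each layer may begin with the full set of tokens.
-/
theorem tokenInv_zero (w : List α) (t : ℕ) (D : Finset ℕ) : TokenInv w t 0 D := by
  constructor
  · intro i i' h h'
    obtain rfl : i' = 0 := by omega
    rw [distinct_self]; omega
  · intro i h
    obtain rfl : i = 0 := by omega
    exact ⟨0, le_rfl, le_rfl, by simp [distinct_self, tokens_self]⟩

theorem TokenInv.bestSum_succ {w : List α} {t j : ℕ} {D : Finset ℕ} (h : TokenInv w t j D) :
    bestSum w (t + 1) j = bestSum w t j + tokens D 0 j := by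
  rw [bestSum]
  apply le_antisymm
  · exact Finset.sup_le fun i hi => h.le 0 i (by omega) (by simp at hi; omega)
  · obtain ⟨i, -, hi, hle⟩ := h.ge 0 (by omega)
    exact hle.trans (Finset.le_sup (f := fun i => bestSum w t i + distinct w i j)
      (Finset.mem_range.2 (by omega)))

/-- One step of the token process: `c` tells whether the value of `t` factors stays the same at
position `j + 1`, and `u` is the token used up at this position (`0` if there is none). -/
theorem TokenInv.step {w : List α} {t j c u : ℕ} {D D' : Finset ℕ} (h : TokenInv w t j D)
    (hj : j < w.length) (hc : bestSum w t (j + 1) + c = bestSum w t j + 1)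
    (hD : j + 1 ∈ D) (hc' : c ≤ 1) (hD' : D' = if c = 0 then D.erase (j + 1) else D)
    (hu : u ≤ lastOcc w j w[j])
    (hu' : u ∈ D') (hmax : ∀ x ∈ D', x ≤ lastOcc w j w[j] → x ≤ u) :
    TokenInv w t (j + 1) (if u = 0 then D' else D'.erase u) ∧
      bestSum w (t + 1) (j + 1) + (if u = 0 then 0 else 1) = bestSum w (t + 1) j + 1 := by
  set p := lastOcc w j w[j] with hp
  have hpj : p ≤ j := lastOcc_le _ _ _
  have hD'D (x : ℕ) (hx : x ≤ j) : x ∈ D' ↔ x ∈ D := by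
    rw [hD']; split_ifs
    · rw [Finset.mem_erase]; exact ⟨fun h => h.2, fun h => ⟨by omega, h⟩⟩
    · rfl
  have huD : u ∈ D := (hD'D u (by omega)).1 hu'
  have hmaxD : ∀ x ∈ D, x ≤ p → x ≤ u := fun x hx hxp => hmax x ((hD'D x (by omega)).2 hx) hxp
  -- Together with `hc` this says that the value at `i` described by the tokens grows by one for `i
  -- ≥ u` and is unchanged for `i < u`. The element `0` is a sentinel: it lies in no `Ioc i j`, so
  -- nothing is counted for it.
  have htok (i : ℕ) (hi : i ≤ j) : tokens (if u = 0 then D' else D'.erase u) i (j + 1)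
      + (if i < u then 1 else 0) = tokens D i j + c := by
    have h1 : tokens D' i (j + 1) = tokens D i j + c := by
      have h2 := tokens_succ D hi
      rw [if_pos hD] at h2
      rw [hD']
      split_ifs with h0
      · have h3 := tokens_erase D hD i (j + 1)
        rw [if_pos (by omega)] at h3
        omega
      · omega
    rw [← h1]
    split_ifs with h0 h2 h2
    · omega
    · rfl
    · rw [← tokens_erase D' hu' i (j + 1), if_pos (by omega)]
    · rw [← tokens_erase D' hu' i (j + 1), if_neg (by omega)]
  generalize (if u = 0 then D' else D'.erase u) = E at htok ⊢
  have hinv : TokenInv w t (j + 1) E := by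
    constructor
    · intro i i' hi hi'
      rcases Nat.lt_or_ge j i' with hij | hij
      · obtain rfl : i' = j + 1 := by omega
        rw [distinct_self]
        omega
      · have h1 := htok i (by omega)
        have h2 := h.le i' i' le_rfl hij
        have h3 := tokens_anti D hi j
        rw [distinct_succ hij hj, ← hp]
        -- For `i < u`, a candidate `i'` that gains one satisfies `u ≤ p ≤ i'`; the token `u`
        -- between `i` and `i'` leaves room for the gain.
        by_cases hiu : i < u
        · rw [if_pos hiu] at h1
          split_ifs with h4
          · have := tokens_lt D huD hiu (by omega : u ≤ i') hij
            omega
          · omega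
        · rw [if_neg hiu] at h1
          split_ifs <;> omega
    · intro i hi
      rcases Nat.lt_or_ge j i with hij | hij
      · obtain rfl : i = j + 1 := by omega
        exact ⟨j + 1, le_rfl, le_rfl, by rw [tokens_self]; omega⟩
      · have h1 := htok i (by omega)
        by_cases hiu : i < u
        · obtain ⟨i', h2, h3, h4⟩ := h.ge i hij
          refine ⟨i', h2, by omega, ?_⟩
          rw [distinct_succ h3 hj, ← hp]
          rw [if_pos hiu] at h1
          omega
        · rw [if_neg hiu] at h1
          -- By maximality of `u` no token lies in `(i, p]` when `i ≥ u`. Hence the old maximum from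
          -- `i` on is attained at some `i' ≥ p`, which gains one.
          have h5 : tokens D i j = tokens D (max i p) j := by
            refine tokens_eq D (fun x hx hix => ?_) (le_max_left _ _) j
            have := hmaxD x hx
            by_contra hc
            omega
          obtain ⟨i', h2, h3, h4⟩ := h.ge (max i p) (by omega)
          refine ⟨i', by omega, by omega, ?_⟩
          rw [distinct_succ h3 hj, ← hp, if_pos (by omega)]
          omega
  refine ⟨hinv, ?_⟩
  rw [hinv.bestSum_succ, h.bestSum_succ]
  have := htok 0 (by omega)
  split_ifs at this ⊢ <;> omega

end Words

namespace WordRAM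

/-! ### A structured language with named variables and arrays, and its compilation -/

/-- Names of scalar variables. -/
inductive Var
  | len | sig | width | base | limb | next | flag | pos | idx | round | tok | blk | seg | lseg
  | bound | acc | carry | blocks
  deriving DecidableEq

/-- Names of arrays. -/
inductive Arr
  | last | prev | keep | bits | id | head | tail | msb
  deriving DecidableEq

def Var.code : Var → ℕ
  | len => 0 | sig => 1 | width => 2 | base => 3 | limb => 4 | next => 5 | flag => 6 | pos => 7
  | idx => 8 | round => 9 | tok => 10 | blk => 11 | seg => 12 | lseg => 13 | bound => 14
  | acc => 15 | carry => 16 | blocks => 17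

def Arr.code : Arr → ℕ
  | last => 0 | prev => 1 | keep => 2 | bits => 3 | id => 4 | head => 5 | tail => 6 | msb => 7

theorem Var.code_injective : Function.Injective Var.code := by
  intro x y h
  cases x <;> cases y <;> first | rfl | (simp [Var.code] at h)

theorem Arr.code_injective : Function.Injective Arr.code := by
  intro x y h
  cases x <;> cases y <;> first | rfl | (simp [Arr.code] at h)

theorem Arr.code_lt (a : Arr) : a.code < 8 := by cases a <;> decide

/-- The state of a structured program. -/
structure State where
  v : Var → ℕ
  arr : Arr → ℕ → ℕ
  inp : List ℕ
  out : List ℕ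

/-- Expressions over variables and array entries. -/
inductive Expr
  | var (x : Var)
  | lit (c : ℕ)
  | bin (o : Op) (e₁ e₂ : Expr)
  | get (a : Arr) (e : Expr)

/-- Structured commands; `cond` and `loop` test whether `e₁ < e₂`. -/
inductive Cmd
  | skip
  | assign (x : Var) (e : Expr)
  | put (a : Arr) (e₁ e₂ : Expr)
  | seq (c₁ c₂ : Cmd)
  | cond (e₁ e₂ : Expr) (c₁ c₂ : Cmd)
  | loop (e₁ e₂ : Expr) (c : Cmd)
  | read (x f : Var)
  | write (e : Expr)

@[simp] def Expr.val (s : State) : Expr → ℕ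
  | var x => s.v x
  | lit c => c
  | bin o e₁ e₂ => o.eval (e₁.val s) (e₂.val s)
  | get a e => s.arr a (e.val s)

/-- All intermediate values are below `M`. -/
@[simp] def Expr.Safe (M : ℕ) (s : State) : Expr → Prop
  | var _ => True
  | lit c => c < M
  | bin o e₁ e₂ => e₁.Safe M s ∧ e₂.Safe M s ∧ o.eval (e₁.val s) (e₂.val s) < M
  | get _ e => e.Safe M s ∧ 24 * e.val s + 26 < M

/-- The number of instructions of an expression. -/
@[simp] def Expr.size : Expr → ℕ
  | var _ => 1
  | lit _ => 1
  | bin _ e₁ e₂ => e₁.size + e₂.size + 1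
  | get _ e => e.size + 5

def State.setVar (s : State) (x : Var) (a : ℕ) : State := { s with v := Function.update s.v x a }

def State.setArr (s : State) (a : Arr) (i c : ℕ) : State :=
  { s with arr := Function.update s.arr a (Function.update (s.arr a) i c) }

/-- Big-step semantics with running time; words are smaller than `M`. -/
inductive Exec (M : ℕ) : Cmd → State → State → ℕ → Prop
  | skip (s : State) : Exec M .skip s s 0
  | assign {s : State} {x : Var} {e : Expr} (he : e.Safe M s) :
      Exec M (.assign x e) s (s.setVar x (e.val s)) (e.size + 1)
  | put {s : State} {a : Arr} {e₁ e₂ : Expr} (h₁ : e₁.Safe M s) (h₂ : e₂.Safe M s)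
      (h : 24 * e₁.val s + 26 < M) :
      Exec M (.put a e₁ e₂) s (s.setArr a (e₁.val s) (e₂.val s)) (e₁.size + e₂.size + 5)
  | seq {s s' s'' : State} {c₁ c₂ : Cmd} {t t' : ℕ} (h₁ : Exec M c₁ s s' t)
      (h₂ : Exec M c₂ s' s'' t') : Exec M (.seq c₁ c₂) s s'' (t + t')
  | condTrue {s s' : State} {e₁ e₂ : Expr} {c₁ c₂ : Cmd} {t : ℕ} (h₁ : e₁.Safe M s)
      (h₂ : e₂.Safe M s) (h : e₁.val s < e₂.val s) (hc : Exec M c₁ s s' t) :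
      Exec M (.cond e₁ e₂ c₁ c₂) s s' (e₁.size + e₂.size + 2 + t)
  | condFalse {s s' : State} {e₁ e₂ : Expr} {c₁ c₂ : Cmd} {t : ℕ} (h₁ : e₁.Safe M s)
      (h₂ : e₂.Safe M s) (h : ¬ e₁.val s < e₂.val s) (hc : Exec M c₂ s s' t) :
      Exec M (.cond e₁ e₂ c₁ c₂) s s' (e₁.size + e₂.size + 2 + t)
  | loopTrue {s s' s'' : State} {e₁ e₂ : Expr} {c : Cmd} {t t' : ℕ} (h₁ : e₁.Safe M s)
      (h₂ : e₂.Safe M s) (h : e₁.val s < e₂.val s) (hc : Exec M c s s' t)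
      (hl : Exec M (.loop e₁ e₂ c) s' s'' t') :
      Exec M (.loop e₁ e₂ c) s s'' (e₁.size + e₂.size + 2 + t + t')
  | loopFalse {s : State} {e₁ e₂ : Expr} {c : Cmd} (h₁ : e₁.Safe M s)
      (h₂ : e₂.Safe M s) (h : ¬ e₁.val s < e₂.val s) :
      Exec M (.loop e₁ e₂ c) s s (e₁.size + e₂.size + 2)
  | readCons {s : State} {x f : Var} {a : ℕ} {l : List ℕ} (h : s.inp = a :: l) (ha : a < M)
      (h1 : 1 < M) :
      Exec M (.read x f) s { (s.setVar x a).setVar f 1 with inp := l } 3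
  | readNil {s : State} {x f : Var} (h : s.inp = []) :
      Exec M (.read x f) s (s.setVar f 0) 2
  | write {s : State} {e : Expr} (he : e.Safe M s) :
      Exec M (.write e) s { s with out := s.out ++ [e.val s] } (e.size + 1)

/-! ### Compilation -/

/-- The residue modulo `3` separates variables, temporaries and arrays. The `8` arrays are
interleaved with stride `24 = 3 * 8`, so all of them can grow without bound. -/
def varAddr (x : Var) : ℕ := 3 * x.code
def tmpAddr (d : ℕ) : ℕ := 3 * d + 1
def arrAddr (a : Arr) (i : ℕ) : ℕ := 24 * i + (3 * a.code + 2)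

/-- Turn an array index in the temporary cell `d` into an address, with the help of cell `d'`. -/
def indexCode (a : Arr) (d d' : ℕ) : List Instr :=
  [.const (tmpAddr d') 24, .op .mul (tmpAddr d) (tmpAddr d) (tmpAddr d'),
    .const (tmpAddr d') (3 * a.code + 2), .op .add (tmpAddr d) (tmpAddr d) (tmpAddr d')]

/-- Code that evaluates an expression into the temporary cell `d`. -/
def Expr.code : Expr → ℕ → List Instr
  | var x, d => [.op .or (tmpAddr d) (varAddr x) (varAddr x)]
  | lit c, d => [.const (tmpAddr d) c]
  | bin o e₁ e₂, d =>
      e₁.code d ++ (e₂.code (d + 1) ++ [.op o (tmpAddr d) (tmpAddr d) (tmpAddr (d + 1))])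
  | get a e, d => e.code d ++ (indexCode a d (d + 1) ++ [.load (tmpAddr d) (tmpAddr d)])

@[simp] theorem Expr.length_code (e : Expr) (d : ℕ) : (e.code d).length = e.size := by
  induction e generalizing d with
  | var x => rfl
  | lit c => rfl
  | bin o e₁ e₂ h₁ h₂ => simp [Expr.code, h₁, h₂]; omega
  | get a e h => simp [Expr.code, h, indexCode]

/-- The number of instructions of a command. -/
def Cmd.size : Cmd → ℕ
  | skip => 0
  | assign _ e => e.size + 1
  | put _ e₁ e₂ => e₁.size + e₂.size + 5
  | seq c₁ c₂ => c₁.size + c₂.size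
  | cond e₁ e₂ c₁ c₂ => e₁.size + e₂.size + 2 + (c₁.size + 1 + c₂.size)
  | loop e₁ e₂ c => e₁.size + e₂.size + 2 + (c.size + 1)
  | read _ _ => 4
  | write e => e.size + 1

/-- The code of a command, placed at position `k` of the program. -/
def Cmd.code : Cmd → ℕ → List Instr
  | skip, _ => []
  | assign x e, _ => e.code 0 ++ [.op .or (varAddr x) (tmpAddr 0) (tmpAddr 0)]
  | put a e₁ e₂, _ => e₁.code 0 ++ (indexCode a 0 1 ++ (e₂.code 1 ++
      [.store (tmpAddr 0) (tmpAddr 1)]))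
  | seq c₁ c₂, k => c₁.code k ++ c₂.code (k + c₁.size)
  | cond e₁ e₂ c₁ c₂, k =>
      let l := k + e₁.size + e₂.size + 2
      e₁.code 0 ++ (e₂.code 1 ++ ([.jlt (tmpAddr 0) (tmpAddr 1) l, .jeq 0 0 (l + c₁.size + 1)] ++
        (c₁.code l ++ ([.jeq 0 0 (l + c₁.size + 1 + c₂.size)] ++ c₂.code (l + c₁.size + 1)))))
  | loop e₁ e₂ c, k =>
      let l := k + e₁.size + e₂.size + 2
      e₁.code 0 ++ (e₂.code 1 ++ ([.jlt (tmpAddr 0) (tmpAddr 1) l, .jeq 0 0 (l + c.size + 1)] ++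
        (c.code l ++ [.jeq 0 0 k])))
  | read x f, k => [.read (varAddr x) (k + 3), .const (varAddr f) 1, .jeq 0 0 (k + 4),
      .const (varAddr f) 0]
  | write e, _ => e.code 0 ++ [.write (tmpAddr 0)]

@[simp] theorem Cmd.length_code (c : Cmd) (k : ℕ) : (c.code k).length = c.size := by
  induction c generalizing k with
  | skip => rfl
  | assign x e => simp [Cmd.code, Cmd.size]
  | put a e₁ e₂ => simp [Cmd.code, Cmd.size, indexCode]; omega
  | seq c₁ c₂ h₁ h₂ => simp [Cmd.code, Cmd.size, h₁, h₂]
  | cond e₁ e₂ c₁ c₂ h₁ h₂ => simp [Cmd.code, Cmd.size, h₁, h₂]; omega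
  | loop e₁ e₂ c h => simp [Cmd.code, Cmd.size, h]; omega
  | read x f => rfl
  | write e => simp [Cmd.code, Cmd.size]

/-- The code `l` stands at position `k` of the program `P`. -/
def CodeAt (P : Program) (k : ℕ) (l : List Instr) : Prop :=
  ∀ i, i < l.length → P[k + i]? = l[i]?

theorem CodeAt.left {P : Program} {k : ℕ} {l l' : List Instr} (h : CodeAt P k (l ++ l')) :
    CodeAt P k l := fun i hi => by
  rw [h i (by simp; omega), List.getElem?_append_left hi]

theorem CodeAt.right {P : Program} {k k' : ℕ} {l l' : List Instr} (h : CodeAt P k (l ++ l'))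
    (hk : k' = k + l.length) : CodeAt P k' l' := fun i hi => by
  rw [hk, add_assoc, h (l.length + i) (by simp; omega), List.getElem?_append_right (by omega)]
  congr 1
  omega

theorem CodeAt.head {P : Program} {k : ℕ} {i : Instr} {l : List Instr}
    (h : CodeAt P k (i :: l)) : P[k]? = some i := by
  simpa using h 0 (by simp)

theorem CodeAt.tail {P : Program} {k k' : ℕ} {i : Instr} {l : List Instr}
    (h : CodeAt P k (i :: l)) (hk : k' = k + 1) : CodeAt P k' l := fun m hm => by
  have := h (m + 1) (by simp; omega)
  rw [hk, add_assoc, add_comm 1 m, this, List.getElem?_cons_succ]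

/-- The configuration `c'` is reached from `c` after exactly `t` steps. -/
def Reach (P : Program) (W t : ℕ) (c c' : Config) : Prop := (step P W)^[t] c = c'

theorem Reach.refl (P : Program) (W : ℕ) (c : Config) : Reach P W 0 c c := rfl

theorem Reach.trans {P : Program} {W t t' t'' : ℕ} {c c' c'' : Config} (h : Reach P W t c c')
    (h' : Reach P W t' c' c'') (ht : t'' = t + t') : Reach P W t'' c c'' := by
  unfold Reach at *
  rw [ht, add_comm, Function.iterate_add_apply, h, h']

theorem Reach.single {P : Program} {W : ℕ} {c : Config} {i : Instr} (h : P[c.pc]? = some i) :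
    Reach P W 1 c (i.exec W c) := by
  simp [Reach, step, h]

/-- A configuration of the machine represents a state. -/
structure Rep (W : ℕ) (s : State) (c : Config) : Prop where
  var : ∀ x, c.mem (varAddr x) = s.v x
  arr : ∀ a i, c.mem (arrAddr a i) = s.arr a i
  inp : c.inp = s.inp
  out : c.out = s.out
  lt : ∀ a, c.mem a < 2 ^ W

/-! ### Correctness of the compiled code -/

theorem varAddr_ne_tmpAddr (x : Var) (d : ℕ) : varAddr x ≠ tmpAddr d := by
  unfold varAddr tmpAddr; omega

theorem arrAddr_ne_tmpAddr (a : Arr) (i d : ℕ) : arrAddr a i ≠ tmpAddr d := by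
  unfold arrAddr tmpAddr; omega

theorem arrAddr_ne_varAddr (a : Arr) (i : ℕ) (x : Var) : arrAddr a i ≠ varAddr x := by
  unfold arrAddr varAddr; omega

theorem arrAddr_inj {a a' : Arr} {i i' : ℕ} (h : arrAddr a i = arrAddr a' i') :
    a = a' ∧ i = i' := by
  have h1 := a.code_lt
  have h2 := a'.code_lt
  unfold arrAddr at h
  exact ⟨Arr.code_injective (by omega), by omega⟩

theorem set_lt {W : ℕ} {c : Config} (h : ∀ a, c.mem a < 2 ^ W) (d v a : ℕ) :
    (c.set W d v).mem a < 2 ^ W := by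
  simp only [Config.set, Function.update_apply]
  split_ifs
  · exact Nat.mod_lt _ (by positivity)
  · exact h a

theorem Rep.setTmp {W : ℕ} {s : State} {c : Config} (h : Rep W s c) (d v : ℕ) :
    Rep W s (c.set W (tmpAddr d) v) where
  var x := by
    simp only [Config.set, Function.update_of_ne (varAddr_ne_tmpAddr x d), h.var]
  arr a i := by
    simp only [Config.set, Function.update_of_ne (arrAddr_ne_tmpAddr a i d), h.arr]
  inp := h.inp
  out := h.out
  lt := set_lt h.lt _ _

theorem Rep.setVar {W : ℕ} {s : State} {c : Config} (h : Rep W s c) (x : Var) {v : ℕ}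
    (hv : v < 2 ^ W) : Rep W (s.setVar x v) (c.set W (varAddr x) v) where
  var y := by
    simp only [Config.set, State.setVar, Function.update_apply, Nat.mod_eq_of_lt hv]
    by_cases hxy : y = x
    · simp [hxy]
    · rw [if_neg (fun he => hxy (Var.code_injective (by unfold varAddr at he; omega))),
        if_neg hxy, h.var]
  arr a i := by
    simp only [Config.set, Function.update_of_ne (arrAddr_ne_varAddr a i x), h.arr, State.setVar]
  inp := h.inp
  out := h.out
  lt := set_lt h.lt _ _

theorem Rep.setArr {W : ℕ} {s : State} {c : Config} (h : Rep W s c) (a : Arr) (i : ℕ) {v : ℕ}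
    (hv : v < 2 ^ W) : Rep W (s.setArr a i v) (c.set W (arrAddr a i) v) where
  var y := by
    simp only [Config.set, Function.update_of_ne (arrAddr_ne_varAddr a i y).symm, h.var,
      State.setArr]
  arr a' i' := by
    simp only [Config.set, State.setArr, Function.update_apply, Nat.mod_eq_of_lt hv]
    by_cases hai : arrAddr a' i' = arrAddr a i
    · obtain ⟨rfl, rfl⟩ := arrAddr_inj hai
      simp
    · rw [if_neg hai, h.arr]
      split_ifs with ha
      · subst ha
        rw [Function.update_of_ne (fun hi => hai (by rw [hi]))]
      · rfl
  inp := h.inp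
  out := h.out
  lt := set_lt h.lt _ _

theorem set_mem_self {W : ℕ} {c : Config} {d v : ℕ} (hv : v < 2 ^ W) :
    (c.set W d v).mem d = v := by
  simp [Config.set, Nat.mod_eq_of_lt hv]

theorem set_mem_of_ne {W : ℕ} {c : Config} {d d' v : ℕ} (h : d' ≠ d) :
    (c.set W d v).mem d' = c.mem d' := by
  simp [Config.set, h]

theorem tmpAddr_ne {d d' : ℕ} (h : d ≠ d') : tmpAddr d ≠ tmpAddr d' := by
  unfold tmpAddr; omega

theorem indexCode_spec {P : Program} {W : ℕ} {s : State} {c : Config} {a : Arr} {d d' v : ℕ}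
    (hd : d ≠ d') (hR : Rep W s c) (hP : CodeAt P c.pc (indexCode a d d'))
    (hv : c.mem (tmpAddr d) = v) (hlt : 24 * v + 26 < 2 ^ W) :
    ∃ c', Reach P W 4 c c' ∧ c'.pc = c.pc + 4 ∧ Rep W s c' ∧ c'.mem (tmpAddr d) = arrAddr a v ∧
      ∀ d'', d'' ≠ d → d'' ≠ d' → c'.mem (tmpAddr d'') = c.mem (tmpAddr d'') := by
  have ha := a.code_lt
  set c1 := c.set W (tmpAddr d') 24 with hc1
  set c2 := c1.set W (tmpAddr d) (c1.mem (tmpAddr d) * c1.mem (tmpAddr d')) with hc2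
  set c3 := c2.set W (tmpAddr d') (3 * a.code + 2) with hc3
  set c4 := c3.set W (tmpAddr d) (c3.mem (tmpAddr d) + c3.mem (tmpAddr d')) with hc4
  have r1 : Reach P W 1 c c1 := Reach.single hP.head
  have r2 : Reach P W 1 c1 c2 :=
    Reach.single (i := .op .mul (tmpAddr d) (tmpAddr d) (tmpAddr d')) (hP.tail rfl).head
  have r3 : Reach P W 1 c2 c3 :=
    Reach.single (i := .const (tmpAddr d') (3 * a.code + 2)) ((hP.tail rfl).tail rfl).head
  have r4 : Reach P W 1 c3 c4 :=
    Reach.single (i := .op .add (tmpAddr d) (tmpAddr d) (tmpAddr d'))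
      (((hP.tail rfl).tail rfl).tail rfl).head
  have hdd := tmpAddr_ne hd
  have m1 : c1.mem (tmpAddr d') = 24 := set_mem_self (by omega)
  have m1' : c1.mem (tmpAddr d) = v := by rw [hc1, set_mem_of_ne hdd, hv]
  have m2 : c2.mem (tmpAddr d) = v * 24 := by
    rw [hc2, m1, m1', set_mem_self (by omega)]
  have m3 : c3.mem (tmpAddr d) = v * 24 := by rw [hc3, set_mem_of_ne hdd, m2]
  have m3' : c3.mem (tmpAddr d') = 3 * a.code + 2 := set_mem_self (by omega)
  have m4 : c4.mem (tmpAddr d) = arrAddr a v := by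
    rw [hc4, m3, m3', set_mem_self (by omega), arrAddr]; ring
  refine ⟨c4, ((r1.trans r2 rfl).trans r3 rfl).trans r4 rfl, rfl,
    (((hR.setTmp _ _).setTmp _ _).setTmp _ _).setTmp _ _, m4, fun d'' h h' => ?_⟩
  rw [hc4, set_mem_of_ne (tmpAddr_ne h), hc3, set_mem_of_ne (tmpAddr_ne h'), hc2,
    set_mem_of_ne (tmpAddr_ne h), hc1, set_mem_of_ne (tmpAddr_ne h')]

/-- The temporaries form a stack: cells below `d` survive, so the left operand is still present
after the right one has been computed. -/
theorem Expr.code_spec {P : Program} {W : ℕ} {s : State} (e : Expr) (d : ℕ) {c : Config}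
    (hR : Rep W s c) (hP : CodeAt P c.pc (e.code d)) (hs : e.Safe (2 ^ W) s) :
    ∃ c', Reach P W e.size c c' ∧ c'.pc = c.pc + e.size ∧ Rep W s c' ∧
      c'.mem (tmpAddr d) = e.val s ∧
      ∀ d', d' < d → c'.mem (tmpAddr d') = c.mem (tmpAddr d') := by
  induction e generalizing d c with
  | var x =>
    refine ⟨_, Reach.single hP.head, rfl, hR.setTmp _ _, ?_, fun d' h => ?_⟩
    -- A copy is performed as the bitwise disjunction of a cell with itself.
    · rw [Instr.exec, Op.eval, Nat.or_self, set_mem_self (hR.lt _), hR.var, Expr.val]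
    · exact set_mem_of_ne (tmpAddr_ne h.ne)
  | lit a =>
    refine ⟨_, Reach.single hP.head, rfl, hR.setTmp _ _, set_mem_self hs, fun d' h => ?_⟩
    exact set_mem_of_ne (tmpAddr_ne h.ne)
  | bin o e₁ e₂ ih₁ ih₂ =>
    obtain ⟨hs₁, hs₂, hs⟩ := hs
    obtain ⟨c1, r1, p1, R1, m1, f1⟩ := ih₁ d hR hP.left hs₁
    have hP2 := hP.right (k' := c1.pc) (by simpa using p1)
    obtain ⟨c2, r2, p2, R2, m2, f2⟩ := ih₂ (d + 1) R1 hP2.left hs₂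
    have hP3 := hP2.right (k' := c2.pc) (by simpa using p2)
    have r3 := Reach.single (W := W) hP3.head
    simp only [Instr.exec] at r3
    refine ⟨_, (r1.trans r2 rfl).trans r3 rfl, ?_, R2.setTmp _ _, ?_, fun d' h => ?_⟩
    · simp only [Config.set, p2, p1, Expr.size]; omega
    · rw [f2 d (by omega), m1, m2, set_mem_self hs, Expr.val]
    · rw [set_mem_of_ne (tmpAddr_ne h.ne), f2 d' (by omega), f1 d' h]
  | get a e ih =>
    obtain ⟨hs, hlt⟩ := hs
    obtain ⟨c1, r1, p1, R1, m1, f1⟩ := ih d hR hP.left hs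
    have hP2 := hP.right (k' := c1.pc) (by simpa using p1)
    obtain ⟨c2, r2, p2, R2, m2, f2⟩ := indexCode_spec (by omega) R1 hP2.left m1 hlt
    have hP3 := hP2.right (k' := c2.pc) (by simpa [indexCode] using p2)
    have r3 := Reach.single (W := W) hP3.head
    simp only [Instr.exec] at r3
    refine ⟨_, (r1.trans r2 rfl).trans r3 rfl, ?_, R2.setTmp _ _, ?_, fun d' h => ?_⟩
    · simp only [Config.set, p2, p1, Expr.size]; omega
    · rw [m2, R2.arr, set_mem_self (by rw [← R2.arr]; exact R2.lt _), Expr.val]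
    · rw [set_mem_of_ne (tmpAddr_ne h.ne), f2 d' (by omega) (by omega), f1 d' h]

theorem Rep.jump {W : ℕ} {s : State} {c : Config} (h : Rep W s c) (p : Prop) [Decidable p]
    (t : ℕ) : Rep W s (c.jump p t) :=
  ⟨h.var, h.arr, h.inp, h.out, h.lt⟩

theorem test_spec {P : Program} {W : ℕ} {s : State} {e₁ e₂ : Expr} {c : Config} {l l' : ℕ}
    {L : List Instr} (hR : Rep W s c)
    (hP : CodeAt P c.pc (e₁.code 0 ++ (e₂.code 1 ++
      ([.jlt (tmpAddr 0) (tmpAddr 1) l, .jeq 0 0 l'] ++ L))))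
    (h₁ : e₁.Safe (2 ^ W) s) (h₂ : e₂.Safe (2 ^ W) s) :
    ∃ c', Reach P W (e₁.size + e₂.size + 1) c c' ∧ Rep W s c' ∧
      CodeAt P (c.pc + e₁.size + e₂.size + 2) L ∧
      c'.pc = (if e₁.val s < e₂.val s then l else c.pc + e₁.size + e₂.size + 1) ∧
      P[c.pc + e₁.size + e₂.size + 1]? = some (.jeq 0 0 l') := by
  obtain ⟨c1, r1, p1, R1, m1, f1⟩ := e₁.code_spec 0 hR hP.left h₁
  have hP2 := hP.right (k' := c1.pc) (by simpa using p1)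
  obtain ⟨c2, r2, p2, R2, m2, f2⟩ := e₂.code_spec 1 R1 hP2.left h₂
  have hP3 := hP2.right (k' := c2.pc) (by simpa using p2)
  have r3 := Reach.single (W := W) hP3.left.head
  refine ⟨_, (r1.trans r2 rfl).trans r3 rfl, R2.jump _ _, ?_, ?_, ?_⟩
  · exact hP3.right (by rw [p2, p1]; rfl)
  · simp only [Instr.exec, Config.jump, m2, f2 0 (by omega), m1, p2, p1]
  · rw [← p1, ← p2]
    exact (hP3.left.tail rfl).head

/-- Comparing a cell with itself serves as the unconditional jump. -/
theorem jeq_spec {P : Program} {W t : ℕ} {s : State} {c : Config} (hR : Rep W s c)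
    (h : P[c.pc]? = some (.jeq 0 0 t)) : ∃ c', Reach P W 1 c c' ∧ c'.pc = t ∧ Rep W s c' :=
  ⟨_, Reach.single h, by simp [Instr.exec, Config.jump], hR.jump _ _⟩

/-- The compiled code does what the command does, in the same number of steps. -/
theorem Exec.simulate {P : Program} {W : ℕ} {cmd : Cmd} {s s' : State} {t : ℕ}
    (h : Exec (2 ^ W) cmd s s' t) {c : Config} (hR : Rep W s c)
    (hP : CodeAt P c.pc (cmd.code c.pc)) :
    ∃ c', Reach P W t c c' ∧ c'.pc = c.pc + cmd.size ∧ Rep W s' c' := by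
  induction h generalizing c with
  | skip s => exact ⟨c, .refl _ _ _, rfl, hR⟩
  | @assign s x e he =>
    obtain ⟨c1, r1, p1, R1, m1, f1⟩ := e.code_spec 0 hR hP.left he
    have hP2 := hP.right (k' := c1.pc) (by simpa using p1)
    have r2 := Reach.single (W := W) hP2.head
    simp only [Instr.exec, Op.eval, Nat.or_self, m1] at r2
    refine ⟨_, r1.trans r2 rfl, ?_, R1.setVar x (m1 ▸ R1.lt _)⟩
    simp only [Config.set, p1, Cmd.size]; omega
  | @put s a e₁ e₂ h₁ h₂ hlt =>
    obtain ⟨c1, r1, p1, R1, m1, f1⟩ := e₁.code_spec 0 hR hP.left h₁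
    have hP2 := hP.right (k' := c1.pc) (by simpa using p1)
    obtain ⟨c2, r2, p2, R2, m2, f2⟩ := indexCode_spec (by omega) R1 hP2.left m1 hlt
    have hP3 := hP2.right (k' := c2.pc) (by simpa [indexCode] using p2)
    obtain ⟨c3, r3, p3, R3, m3, f3⟩ := e₂.code_spec 1 R2 hP3.left h₂
    have hP4 := hP3.right (k' := c3.pc) (by simpa using p3)
    have r4 := Reach.single (W := W) hP4.head
    simp only [Instr.exec, f3 0 (by omega), m2, m3] at r4
    refine ⟨_, ((r1.trans r2 rfl).trans r3 rfl).trans r4 (by omega), ?_,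
      R3.setArr a _ (m3 ▸ R3.lt _)⟩
    simp only [Config.set, p1, p2, p3, Cmd.size]; omega
  | seq _ _ ih₁ ih₂ =>
    obtain ⟨c1, r1, p1, R1⟩ := ih₁ hR hP.left
    have hP2 := hP.right (k' := c1.pc) (by simpa using p1)
    obtain ⟨c2, r2, p2, R2⟩ := ih₂ R1 (by rwa [← p1] at hP2)
    exact ⟨c2, r1.trans r2 rfl, by rw [p2, p1, Cmd.size, add_assoc], R2⟩
  | condTrue h₁ h₂ hlt _ ih =>
    obtain ⟨c1, r1, R1, hP1, p1, -⟩ := test_spec hR hP h₁ h₂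
    rw [if_pos hlt] at p1
    obtain ⟨c2, r2, p2, R2⟩ := ih R1 (by rw [p1]; exact hP1.left)
    have hP2 := (hP1.right (by simp; rfl)).left.head
    rw [← p1, ← p2] at hP2
    obtain ⟨c3, r3, p3, R3⟩ := jeq_spec R2 hP2
    refine ⟨c3, (r1.trans r2 rfl).trans r3 (by omega), ?_, R3⟩
    rw [p3, Cmd.size]; omega
  | condFalse h₁ h₂ hlt _ ih =>
    obtain ⟨c1, r1, R1, hP1, p1, hj⟩ := test_spec hR hP h₁ h₂
    rw [if_neg hlt] at p1
    rw [← p1] at hj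
    obtain ⟨c2, r2, p2, R2⟩ := jeq_spec R1 hj
    have hP2 := (hP1.right rfl).right rfl
    simp only [Cmd.length_code, List.length_singleton] at hP2
    rw [← p2] at hP2
    obtain ⟨c3, r3, p3, R3⟩ := ih R2 hP2
    refine ⟨c3, (r1.trans r2 rfl).trans r3 (by omega), ?_, R3⟩
    rw [p3, p2, Cmd.size]; omega
  | loopTrue h₁ h₂ hlt _ _ ih ih' =>
    obtain ⟨c1, r1, R1, hP1, p1, -⟩ := test_spec hR hP h₁ h₂
    rw [if_pos hlt] at p1
    obtain ⟨c2, r2, p2, R2⟩ := ih R1 (by rw [p1]; exact hP1.left)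
    have hP2 := (hP1.right (by simp; rfl)).head
    rw [← p1, ← p2] at hP2
    obtain ⟨c3, r3, p3, R3⟩ := jeq_spec R2 hP2
    obtain ⟨c4, r4, p4, R4⟩ := ih' R3 (by rwa [p3])
    exact ⟨c4, ((r1.trans r2 rfl).trans r3 rfl).trans r4 (by omega), by rw [p4, p3], R4⟩
  | loopFalse h₁ h₂ hlt =>
    obtain ⟨c1, r1, R1, hP1, p1, hj⟩ := test_spec hR hP h₁ h₂
    rw [if_neg hlt] at p1
    rw [← p1] at hj
    obtain ⟨c2, r2, p2, R2⟩ := jeq_spec R1 hj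
    refine ⟨c2, r1.trans r2 rfl, ?_, R2⟩
    rw [p2, Cmd.size]; omega
  | @readCons s x f a l hi ha h1 =>
    have r1 := Reach.single (W := W) hP.head
    have hc : c.inp = a :: l := by rw [hR.inp, hi]
    simp only [Instr.exec, hc] at r1
    have R1 := hR.setVar x ha
    set c1 : Config := { c.set W (varAddr x) a with inp := l } with hc1
    have R1' : Rep W { s.setVar x a with inp := l } c1 := ⟨R1.var, R1.arr, rfl, R1.out, R1.lt⟩
    have r2 : Reach P W 1 c1 (c1.set W (varAddr f) 1) :=
      Reach.single (i := .const (varAddr f) 1) (hP.tail rfl).head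
    have R2 := R1'.setVar f (v := 1) h1
    obtain ⟨c3, r3, p3, R3⟩ := jeq_spec R2 (((hP.tail rfl).tail rfl).head)
    exact ⟨c3, (r1.trans r2 rfl).trans r3 rfl, p3, R3⟩
  | @readNil s x f hi =>
    have r1 := Reach.single (W := W) hP.head
    have hc : c.inp = [] := by rw [hR.inp, hi]
    simp only [Instr.exec, hc] at r1
    set c1 : Config := { c with pc := c.pc + 3, inp := [] } with hc1
    have R1 : Rep W s c1 := ⟨hR.var, hR.arr, hi.symm, hR.out, hR.lt⟩
    have r2 : Reach P W 1 c1 (c1.set W (varAddr f) 0) :=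
      Reach.single (i := .const (varAddr f) 0) (((hP.tail rfl).tail rfl).tail rfl).head
    exact ⟨_, Reach.trans r1 r2 rfl, rfl, R1.setVar f (by positivity)⟩
  | @write s e he =>
    obtain ⟨c1, r1, p1, R1, m1, f1⟩ := e.code_spec 0 hR hP.left he
    have hP2 := hP.right (k' := c1.pc) (by simpa using p1)
    have r2 := Reach.single (W := W) hP2.head
    simp only [Instr.exec, m1] at r2
    refine ⟨_, r1.trans r2 rfl, ?_, R1.var, R1.arr, R1.inp, ?_, R1.lt⟩
    · simp only [p1, Cmd.size]; omega
    · simp only [R1.out]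

/-- The state at the start. -/
def State.start (input : List ℕ) : State := ⟨fun _ => 0, fun _ _ => 0, input, []⟩

/-- A halted configuration is a fixed point of `step`, so the exact running time may be replaced by
any upper bound. -/
theorem Exec.haltsWithin {W : ℕ} {cmd : Cmd} {input : List ℕ} {s : State} {t t' : ℕ}
    (h : Exec (2 ^ W) cmd (.start input) s t) (ht : t ≤ t') :
    HaltsWithin (cmd.code 0) W input t' s.out := by
  have hR : Rep W (.start input) (.start input) :=
    ⟨fun _ => rfl, fun _ _ => rfl, rfl, rfl, fun _ => by simp [Config.start]⟩
  obtain ⟨c, hr, hpc, hc⟩ := h.simulate (P := cmd.code 0) hR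
    (fun i hi => by simp [Config.start])
  have hh : Halted (cmd.code 0) c := by
    rw [Halted, hpc, Cmd.length_code]; exact Nat.le_add_left _ _
  have hfix : step (cmd.code 0) W c = c := by
    rw [step, List.getElem?_eq_none hh]
  have : Reach (cmd.code 0) W t' (.start input) c :=
    hr.trans (Function.iterate_fixed hfix (t' - t)) (by omega)
  rw [HaltsWithin, this]
  exact ⟨hh, hc.out⟩

/-! ### Weakest preconditions -/

/-- The weakest precondition of a command with respect to a condition on the final state and the
running time. -/
@[simp] def Cmd.wp (M : ℕ) : Cmd → (State → ℕ → Prop) → State → Prop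
  | skip, Q, s => Q s 0
  | assign x e, Q, s => e.Safe M s ∧ Q (s.setVar x (e.val s)) (e.size + 1)
  | put a e₁ e₂, Q, s => e₁.Safe M s ∧ e₂.Safe M s ∧ 24 * e₁.val s + 26 < M ∧
      Q (s.setArr a (e₁.val s) (e₂.val s)) (e₁.size + e₂.size + 5)
  | seq c₁ c₂, Q, s => c₁.wp M (fun s' t => c₂.wp M (fun s'' t' => Q s'' (t + t')) s') s
  | cond e₁ e₂ c₁ c₂, Q, s => e₁.Safe M s ∧ e₂.Safe M s ∧
      (e₁.val s < e₂.val s → c₁.wp M (fun s' t => Q s' (e₁.size + e₂.size + 2 + t)) s) ∧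
      (¬ e₁.val s < e₂.val s → c₂.wp M (fun s' t => Q s' (e₁.size + e₂.size + 2 + t)) s)
  | loop e₁ e₂ c, Q, s => ∃ s' t, Exec M (.loop e₁ e₂ c) s s' t ∧ Q s' t
  | read x f, Q, s =>
      (∀ a l, s.inp = a :: l →
        a < M ∧ 1 < M ∧ Q { (s.setVar x a).setVar f 1 with inp := l } 3) ∧
      (s.inp = [] → Q (s.setVar f 0) 2)
  | write e, Q, s => e.Safe M s ∧ Q { s with out := s.out ++ [e.val s] } (e.size + 1)

theorem Cmd.exists_exec_of_wp {M : ℕ} {c : Cmd} {Q : State → ℕ → Prop} {s : State}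
    (h : c.wp M Q s) : ∃ s' t, Exec M c s s' t ∧ Q s' t := by
  induction c generalizing Q s with
  | skip => exact ⟨s, 0, .skip s, h⟩
  | assign x e => exact ⟨_, _, .assign h.1, h.2⟩
  | put a e₁ e₂ => exact ⟨_, _, .put h.1 h.2.1 h.2.2.1, h.2.2.2⟩
  | seq c₁ c₂ ih₁ ih₂ =>
    obtain ⟨s', t, h₁, h'⟩ := ih₁ h
    obtain ⟨s'', t', h₂, h''⟩ := ih₂ h'
    exact ⟨s'', t + t', .seq h₁ h₂, h''⟩
  | cond e₁ e₂ c₁ c₂ ih₁ ih₂ =>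
    obtain ⟨h₁, h₂, ht, hf⟩ := h
    by_cases hc : e₁.val s < e₂.val s
    · obtain ⟨s', t, h', hQ⟩ := ih₁ (ht hc)
      exact ⟨s', _, .condTrue h₁ h₂ hc h', hQ⟩
    · obtain ⟨s', t, h', hQ⟩ := ih₂ (hf hc)
      exact ⟨s', _, .condFalse h₁ h₂ hc h', hQ⟩
  | loop e₁ e₂ c _ => exact h
  | read x f =>
    cases hi : s.inp with
    | nil => exact ⟨_, _, .readNil hi, h.2 hi⟩
    | cons a l =>
      obtain ⟨ha, h1, hQ⟩ := h.1 a l hi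
      exact ⟨_, _, .readCons hi ha h1, hQ⟩
  | write e => exact ⟨_, _, .write h.1, h.2⟩

/-- Lets the specification of a subprogram be used inside the weakest precondition of a larger one.
-/
theorem Exec.wp {M : ℕ} {c : Cmd} {Q : State → ℕ → Prop} {s s' : State} {t : ℕ}
    (h : Exec M c s s' t) (hQ : Q s' t) : c.wp M Q s := by
  induction h generalizing Q with
  | skip => exact hQ
  | assign he => exact ⟨he, hQ⟩
  | put h₁ h₂ h => exact ⟨h₁, h₂, h, hQ⟩
  | seq _ _ ih₁ ih₂ => exact ih₁ (ih₂ hQ)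
  | condTrue h₁ h₂ h _ ih => exact ⟨h₁, h₂, fun _ => ih hQ, fun hn => absurd h hn⟩
  | condFalse h₁ h₂ h _ ih => exact ⟨h₁, h₂, fun hp => absurd hp h, fun _ => ih hQ⟩
  | loopTrue h₁ h₂ h hc hl _ _ => exact ⟨_, _, .loopTrue h₁ h₂ h hc hl, hQ⟩
  | loopFalse h₁ h₂ h => exact ⟨_, _, .loopFalse h₁ h₂ h, hQ⟩
  | readCons h ha h1 =>
    refine ⟨fun a l hi => ?_, fun hi => by simp [h] at hi⟩
    rw [h, List.cons.injEq] at hi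
    obtain ⟨rfl, rfl⟩ := hi
    exact ⟨ha, h1, hQ⟩
  | readNil h => exact ⟨fun a l hi => by simp [h] at hi, fun _ => hQ⟩
  | write he => exact ⟨he, hQ⟩

/-- A counting loop with an invariant `I` that depends on the number of rounds and the time. -/
theorem exec_loop {M : ℕ} {e₁ e₂ : Expr} {c : Cmd} (I : ℕ → State → ℕ → Prop) {i N : ℕ}
    (hstep : ∀ i s t, i < N → I i s t → e₁.Safe M s ∧ e₂.Safe M s ∧ e₁.val s < e₂.val s ∧
      c.wp M (fun s' t' => I (i + 1) s' (t + (e₁.size + e₂.size + 2 + t'))) s)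
    (hend : ∀ s t, I N s t → e₁.Safe M s ∧ e₂.Safe M s ∧ ¬ e₁.val s < e₂.val s)
    (hi : i ≤ N) {s : State} {t : ℕ} (h : I i s t) :
    ∃ s' t', Exec M (.loop e₁ e₂ c) s s' (t' + (e₁.size + e₂.size + 2)) ∧ I N s' (t + t') := by
  induction hd : N - i generalizing i s t with
  | zero =>
    obtain rfl : i = N := by omega
    obtain ⟨h₁, h₂, h₃⟩ := hend s t h
    exact ⟨s, 0, by simpa using .loopFalse h₁ h₂ h₃, h⟩
  | succ d ih =>
    obtain ⟨h₁, h₂, h₃, h₄⟩ := hstep i s t (by omega) h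
    obtain ⟨s', t', hc, hI⟩ := Cmd.exists_exec_of_wp h₄
    obtain ⟨s'', t'', hl, hI'⟩ := ih (by omega) hI (by omega)
    refine ⟨s'', e₁.size + e₂.size + 2 + t' + t'', ?_, ?_⟩
    · have := Exec.loopTrue h₁ h₂ h₃ hc hl
      rwa [← add_assoc] at this
    · rwa [add_assoc] at hI'

theorem wp_loop {M : ℕ} {e₁ e₂ : Expr} {c : Cmd} {Q : State → ℕ → Prop}
    (I : ℕ → State → ℕ → Prop) {i N : ℕ} {s : State} (h : I i s 0) (hi : i ≤ N)
    (hstep : ∀ i s t, i < N → I i s t → e₁.Safe M s ∧ e₂.Safe M s ∧ e₁.val s < e₂.val s ∧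
      c.wp M (fun s' t' => I (i + 1) s' (t + (e₁.size + e₂.size + 2 + t'))) s)
    (hend : ∀ s t, I N s t → (e₁.Safe M s ∧ e₂.Safe M s ∧ ¬ e₁.val s < e₂.val s) ∧
      Q s (t + (e₁.size + e₂.size + 2))) :
    (Cmd.loop e₁ e₂ c).wp M Q s := by
  obtain ⟨s', t', hx, hI⟩ := exec_loop I hstep (fun s t h => (hend s t h).1) hi h
  rw [zero_add] at hI
  exact ⟨s', _, hx, (hend s' t' hI).2⟩

/-! ### Frame conditions -/

/-- The command assigns to the variable `y`. -/
def Cmd.setsVar (y : Var) : Cmd → Bool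
  | skip => false
  | assign x _ => x = y
  | put _ _ _ => false
  | seq c₁ c₂ => c₁.setsVar y || c₂.setsVar y
  | cond _ _ c₁ c₂ => c₁.setsVar y || c₂.setsVar y
  | loop _ _ c => c.setsVar y
  | read x f => x = y || f = y
  | write _ => false

/-- The command stores into the array `b`. -/
def Cmd.setsArr (b : Arr) : Cmd → Bool
  | put a _ _ => a = b
  | seq c₁ c₂ => c₁.setsArr b || c₂.setsArr b
  | cond _ _ c₁ c₂ => c₁.setsArr b || c₂.setsArr b
  | loop _ _ c => c.setsArr b
  | _ => false

/-- The command reads or writes on the tapes. -/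
def Cmd.usesTapes : Cmd → Bool
  | seq c₁ c₂ => c₁.usesTapes || c₂.usesTapes
  | cond _ _ c₁ c₂ => c₁.usesTapes || c₂.usesTapes
  | loop _ _ c => c.usesTapes
  | read _ _ => true
  | write _ => true
  | _ => false

theorem Exec.var_eq {M : ℕ} {c : Cmd} {s s' : State} {t : ℕ} (h : Exec M c s s' t) {y : Var}
    (hy : c.setsVar y = false) : s'.v y = s.v y := by
  induction h with
  | skip => rfl
  | assign => 
    simp only [Cmd.setsVar, decide_eq_false_iff_not] at hy
    exact Function.update_of_ne (Ne.symm hy) _ _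
  | put => rfl
  | seq _ _ ih₁ ih₂ =>
    simp only [Cmd.setsVar, Bool.or_eq_false_iff] at hy
    rw [ih₂ hy.2, ih₁ hy.1]
  | condTrue _ _ _ _ ih =>
    simp only [Cmd.setsVar, Bool.or_eq_false_iff] at hy
    exact ih hy.1
  | condFalse _ _ _ _ ih =>
    simp only [Cmd.setsVar, Bool.or_eq_false_iff] at hy
    exact ih hy.2
  | loopTrue _ _ _ _ _ ih ih' => rw [ih' hy, ih hy]
  | loopFalse => rfl
  | readCons =>
    simp only [Cmd.setsVar, Bool.or_eq_false_iff, decide_eq_false_iff_not] at hy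
    simp [State.setVar, Ne.symm hy.1, Ne.symm hy.2]
  | readNil =>
    simp only [Cmd.setsVar, Bool.or_eq_false_iff, decide_eq_false_iff_not] at hy
    simp [State.setVar, Ne.symm hy.2]
  | write => rfl

theorem Exec.arr_eq {M : ℕ} {c : Cmd} {s s' : State} {t : ℕ} (h : Exec M c s s' t) {b : Arr}
    (hb : c.setsArr b = false) : s'.arr b = s.arr b := by
  induction h with
  | put =>
    simp only [Cmd.setsArr, decide_eq_false_iff_not] at hb
    exact Function.update_of_ne (Ne.symm hb) _ _
  | seq _ _ ih₁ ih₂ =>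
    simp only [Cmd.setsArr, Bool.or_eq_false_iff] at hb
    rw [ih₂ hb.2, ih₁ hb.1]
  | condTrue _ _ _ _ ih =>
    simp only [Cmd.setsArr, Bool.or_eq_false_iff] at hb
    exact ih hb.1
  | condFalse _ _ _ _ ih =>
    simp only [Cmd.setsArr, Bool.or_eq_false_iff] at hb
    exact ih hb.2
  | loopTrue _ _ _ _ _ ih ih' => rw [ih' hb, ih hb]
  | _ => rfl

theorem Exec.tapes_eq {M : ℕ} {c : Cmd} {s s' : State} {t : ℕ} (h : Exec M c s s' t)
    (hc : c.usesTapes = false) : s'.inp = s.inp ∧ s'.out = s.out := by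
  induction h with
  | seq _ _ ih₁ ih₂ =>
    simp only [Cmd.usesTapes, Bool.or_eq_false_iff] at hc
    exact ⟨(ih₂ hc.2).1.trans (ih₁ hc.1).1, (ih₂ hc.2).2.trans (ih₁ hc.1).2⟩
  | condTrue _ _ _ _ ih =>
    simp only [Cmd.usesTapes, Bool.or_eq_false_iff] at hc
    exact ih hc.1
  | condFalse _ _ _ _ ih =>
    simp only [Cmd.usesTapes, Bool.or_eq_false_iff] at hc
    exact ih hc.2
  | loopTrue _ _ _ _ _ ih ih' =>
    exact ⟨(ih' hc).1.trans (ih hc).1, (ih' hc).2.trans (ih hc).2⟩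
  | readCons | readNil | write => simp [Cmd.usesTapes] at hc
  | _ => exact ⟨rfl, rfl⟩

end WordRAM

namespace WordRAM

/-! ### Predecessor search with bit blocks and intervals of blocks -/

theorem testBit_log_two {x : ℕ} (h : x ≠ 0) : x.testBit (Nat.log 2 x) = true := by
  rw [Nat.testBit_eq_decide_div_mod_eq, decide_eq_true_eq]
  have h1 := Nat.pow_log_le_self 2 h
  have h2 := Nat.lt_pow_succ_log_self (b := 2) (by norm_num) x
  have h3 : x / 2 ^ Nat.log 2 x = 1 := by
    refine Nat.div_eq_of_lt_le (by omega) ?_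
    rw [pow_succ] at h2
    omega
  rw [h3]

theorem le_log_two_of_testBit {x i : ℕ} (h : x.testBit i = true) : i ≤ Nat.log 2 x :=
  Nat.le_log_of_pow_le (by norm_num) (Nat.ge_two_pow_of_testBit h)

/-- The numbers below `m` are partitioned into intervals `[head, tail)`; `id` is the name of the
interval of a number, and the numbers with `nz` are the first elements of the intervals. -/
structure Intervals (m : ℕ) (nz : ℕ → Prop) (id head tail : ℕ → ℕ) : Prop where
  id_lt : ∀ i < m, id i < m
  head_le : ∀ i < m, head (id i) ≤ i
  lt_tail : ∀ i < m, i < tail (id i)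
  tail_le : ∀ i < m, tail (id i) ≤ m
  id_eq : ∀ i < m, ∀ i', head (id i) ≤ i' → i' < tail (id i) → id i' = id i
  head_nz : ∀ i < m, nz (head (id i))
  not_nz : ∀ i < m, ∀ i', head (id i) < i' → i' < tail (id i) → ¬ nz i'

/-- The potential that pays for the merging of intervals. -/
def potential (m : ℕ) (id head tail : ℕ → ℕ) : ℕ :=
  ∑ i ∈ Finset.range m, Nat.log 2 (tail (id i) - head (id i))

theorem Intervals.congr {m : ℕ} {nz nz' : ℕ → Prop} {id head tail : ℕ → ℕ}
    (h : Intervals m nz id head tail) (hn : ∀ i < m, nz i ↔ nz' i) :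
    Intervals m nz' id head tail where
  id_lt := h.id_lt
  head_le := h.head_le
  lt_tail := h.lt_tail
  tail_le := h.tail_le
  id_eq := h.id_eq
  head_nz i hi := (hn _ ((h.head_le i hi).trans_lt hi)).1 (h.head_nz i hi)
  not_nz i hi i' h1 h2 h3 := h.not_nz i hi i' h1 h2
    ((hn _ (h2.trans_le (h.tail_le i hi))).2 h3)

theorem Intervals.head_id {m : ℕ} {nz : ℕ → Prop} {id head tail : ℕ → ℕ}
    (h : Intervals m nz id head tail) {q : ℕ} (hq : q < m) (hz : nz q) : head (id q) = q := by
  have h1 := h.head_le q hq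
  have h2 := h.lt_tail q hq
  by_contra hc
  exact h.not_nz q hq q (by omega) h2 hz

theorem Intervals.tail_id_pred {m : ℕ} {nz : ℕ → Prop} {id head tail : ℕ → ℕ}
    (h : Intervals m nz id head tail) {q : ℕ} (hq : q < m) (hq0 : 0 < q) (hz : nz q) :
    tail (id (q - 1)) = q := by
  have h1 := h.lt_tail (q - 1) (by omega)
  have h2 := h.head_le (q - 1) (by omega)
  by_contra hc
  exact h.not_nz (q - 1) (by omega) q (by omega) (by omega) hz

/-- Merging the interval that begins with `q` into its left neighbour. -/
theorem Intervals.merge {m : ℕ} {nz : ℕ → Prop} {id head tail id' head' tail' : ℕ → ℕ}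
    (h : Intervals m nz id head tail) {q k : ℕ} (hq : q < m) (hq0 : 0 < q) (hz : nz q)
    (hk : k < m) (hhead : head' k = head (id (q - 1))) (htail : tail' k = tail (id q))
    (hin : ∀ i, head (id (q - 1)) ≤ i → i < tail (id q) → id' i = k)
    (hout : ∀ i < m, ¬ (head (id (q - 1)) ≤ i ∧ i < tail (id q)) →
      id' i = id i ∧ head' (id i) = head (id i) ∧ tail' (id i) = tail (id i)) :
    Intervals m (fun i => nz i ∧ i ≠ q) id' head' tail' := by
  have hq1 : q - 1 < m := by omega
  have e1 := h.head_id hq hz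
  have e2 := h.tail_id_pred hq hq0 hz
  have e3 := h.head_le (q - 1) hq1
  have e4 := h.lt_tail q hq
  have e5 := h.tail_le q hq
  -- An interval not contained in the merged range is disjoint from it: a common point would give
  -- both the same name, hence the same ends.
  have hsep (i : ℕ) (hi : i < m) (hni : ¬ (head (id (q - 1)) ≤ i ∧ i < tail (id q))) (i' : ℕ)
      (h1 : head (id i) ≤ i') (h2 : i' < tail (id i)) :
      ¬ (head (id (q - 1)) ≤ i' ∧ i' < tail (id q)) := by
    rintro ⟨h3, h4⟩
    have h5 := h.id_eq i hi i' h1 h2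
    have h6 := h.head_le i hi
    have h7 := h.lt_tail i hi
    apply hni
    rcases Nat.lt_or_ge i' q with hc | hc
    · have h8 := h.id_eq (q - 1) hq1 i' h3 (by omega)
      rw [← h5, h8] at h6 h7
      omega
    · have h8 := h.id_eq q hq i' (by omega) h4
      rw [← h5, h8] at h6 h7
      omega
  constructor
  · intro i hi
    by_cases hc : head (id (q - 1)) ≤ i ∧ i < tail (id q)
    · rw [hin i hc.1 hc.2]; exact hk
    · rw [(hout i hi hc).1]; exact h.id_lt i hi
  · intro i hi
    by_cases hc : head (id (q - 1)) ≤ i ∧ i < tail (id q)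
    · rw [hin i hc.1 hc.2, hhead]; exact hc.1
    · rw [(hout i hi hc).1, (hout i hi hc).2.1]; exact h.head_le i hi
  · intro i hi
    by_cases hc : head (id (q - 1)) ≤ i ∧ i < tail (id q)
    · rw [hin i hc.1 hc.2, htail]; exact hc.2
    · rw [(hout i hi hc).1, (hout i hi hc).2.2]; exact h.lt_tail i hi
  · intro i hi
    by_cases hc : head (id (q - 1)) ≤ i ∧ i < tail (id q)
    · rw [hin i hc.1 hc.2, htail]; exact e5
    · rw [(hout i hi hc).1, (hout i hi hc).2.2]; exact h.tail_le i hi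
  · intro i hi i'
    by_cases hc : head (id (q - 1)) ≤ i ∧ i < tail (id q)
    · rw [hin i hc.1 hc.2, htail, hhead]; exact hin i'
    · rw [(hout i hi hc).1, (hout i hi hc).2.1, (hout i hi hc).2.2]
      intro h1 h2
      rw [(hout i' (h2.trans_le (h.tail_le i hi)) (hsep i hi hc i' h1 h2)).1]
      exact h.id_eq i hi i' h1 h2
  · intro i hi
    by_cases hc : head (id (q - 1)) ≤ i ∧ i < tail (id q)
    · rw [hin i hc.1 hc.2, hhead]
      exact ⟨h.head_nz _ hq1, by omega⟩
    · rw [(hout i hi hc).1, (hout i hi hc).2.1]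
      refine ⟨h.head_nz i hi, fun he => ?_⟩
      have h1 := h.head_le i hi
      have h2 := h.lt_tail i hi
      exact hsep i hi hc q he.le (by omega) ⟨by omega, e4⟩
  · intro i hi i'
    by_cases hc : head (id (q - 1)) ≤ i ∧ i < tail (id q)
    · rw [hin i hc.1 hc.2, htail, hhead]
      rintro h1 h2 ⟨h3, h4⟩
      rcases Nat.lt_or_ge i' q with h5 | h5
      · exact h.not_nz (q - 1) hq1 i' h1 (by omega) h3
      · exact h.not_nz q hq i' (by omega) h2 h3
    · rw [(hout i hi hc).1, (hout i hi hc).2.1, (hout i hi hc).2.2]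
      exact fun h1 h2 h3 => h.not_nz i hi i' h1 h2 h3.1

/-- Doubling the length of an interval raises its binary logarithm by one, so each relabelled block
pays for itself with one unit of potential. -/
theorem potential_add_le {m : ℕ} {id head tail id' head' tail' : ℕ → ℕ} {lo hi : ℕ} (hm : hi ≤ m)
    (h : ∀ i < m, tail (id i) - head (id i) ≤ tail' (id' i) - head' (id' i))
    (h2 : ∀ i, lo ≤ i → i < hi → 0 < tail (id i) - head (id i) ∧
      2 * (tail (id i) - head (id i)) ≤ tail' (id' i) - head' (id' i)) :
    potential m id head tail + (hi - lo) ≤ potential m id' head' tail' := by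
  have hsub : Finset.Ico lo hi ⊆ Finset.range m := fun i hi' => by
    rw [Finset.mem_Ico] at hi'
    exact Finset.mem_range.2 (by omega)
  have hcard : hi - lo = ∑ i ∈ Finset.range m, if i ∈ Finset.Ico lo hi then 1 else 0 := by
    rw [Finset.sum_ite_mem, Finset.inter_eq_right.2 hsub]
    simp
  rw [hcard, potential, potential, ← Finset.sum_add_distrib]
  refine Finset.sum_le_sum fun i hi' => ?_
  split_ifs with hc
  · rw [Finset.mem_Ico] at hc
    obtain ⟨h3, h4⟩ := h2 i hc.1 hc.2
    rw [← Nat.log_mul_base (by norm_num) (by omega)]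
    exact Nat.log_mono_right (by omega)
  · rw [add_zero]
    exact Nat.log_mono_right (h i (Finset.mem_range.1 hi'))

theorem Intervals.potential_le {m : ℕ} {nz : ℕ → Prop} {id head tail : ℕ → ℕ}
    (h : Intervals m nz id head tail) : potential m id head tail ≤ m * Nat.log 2 m := by
  have := Finset.sum_le_card_nsmul (Finset.range m)
    (fun i => Nat.log 2 (tail (id i) - head (id i))) (Nat.log 2 m) (fun i hi => by
      have := h.tail_le i (Finset.mem_range.1 hi)
      exact Nat.log_mono_right (by omega))
  simpa [potential] using this

/-- The right interval is not longer than the left one, so its blocks take over the left name and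
land in an interval at least twice as long. `Intervals.merge_right` is the mirror case. -/
theorem Intervals.merge_left {m : ℕ} {nz : ℕ → Prop} {id head tail : ℕ → ℕ}
    (h : Intervals m nz id head tail) {q : ℕ} (hq : q < m) (hq0 : 0 < q) (hz : nz q)
    (hs : tail (id q) - q ≤ q - head (id (q - 1))) :
    Intervals m (fun i => nz i ∧ i ≠ q)
        (fun i => if q ≤ i ∧ i < tail (id q) then id (q - 1) else id i) head
        (Function.update tail (id (q - 1)) (tail (id q))) ∧
      potential m id head tail + (tail (id q) - q) ≤ potential m
        (fun i => if q ≤ i ∧ i < tail (id q) then id (q - 1) else id i) head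
        (Function.update tail (id (q - 1)) (tail (id q))) := by
  have hq1 : q - 1 < m := by omega
  have e1 := h.head_id hq hz
  have e2 := h.tail_id_pred hq hq0 hz
  have e3 := h.head_le (q - 1) hq1
  have e4 := h.lt_tail q hq
  have e5 := h.tail_le q hq
  have hl (i : ℕ) (h1 : head (id (q - 1)) ≤ i) (h2 : i < q) : id i = id (q - 1) :=
    h.id_eq (q - 1) hq1 i h1 (by omega)
  have hr (i : ℕ) (h1 : q ≤ i) (h2 : i < tail (id q)) : id i = id q :=
    h.id_eq q hq i (by omega) h2
  have hne (i : ℕ) (hi : i < m) (hc : ¬ (head (id (q - 1)) ≤ i ∧ i < tail (id q))) :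
      id i ≠ id (q - 1) := fun he => by
    have h1 := h.head_le i hi
    have h2 := h.lt_tail i hi
    rw [he] at h1 h2
    omega
  constructor
  · refine h.merge hq hq0 hz (h.id_lt _ hq1) rfl (by simp) (fun i h1 h2 => ?_) fun i hi hc => ?_
    · split_ifs with h3
      · rfl
      · exact hl i h1 (by omega)
    · rw [if_neg (by omega), Function.update_of_ne (hne i hi hc)]
      exact ⟨rfl, rfl, rfl⟩
  · refine potential_add_le e5 (fun i hi => ?_) (fun i h1 h2 => ?_)
    · by_cases hc : q ≤ i ∧ i < tail (id q)
      · rw [if_pos hc, Function.update_self, hr i hc.1 hc.2]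
        omega
      · rw [if_neg hc, Function.update_apply]
        split_ifs with h3
        · rw [h3]; omega
        · rfl
    · rw [if_pos ⟨h1, h2⟩, Function.update_self, hr i h1 h2]
      omega

theorem Intervals.merge_right {m : ℕ} {nz : ℕ → Prop} {id head tail : ℕ → ℕ}
    (h : Intervals m nz id head tail) {q : ℕ} (hq : q < m) (hq0 : 0 < q) (hz : nz q)
    (hs : q - head (id (q - 1)) ≤ tail (id q) - q) :
    Intervals m (fun i => nz i ∧ i ≠ q)
        (fun i => if head (id (q - 1)) ≤ i ∧ i < q then id q else id i)
        (Function.update head (id q) (head (id (q - 1)))) tail ∧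
      potential m id head tail + (q - head (id (q - 1))) ≤ potential m
        (fun i => if head (id (q - 1)) ≤ i ∧ i < q then id q else id i)
        (Function.update head (id q) (head (id (q - 1)))) tail := by
  have hq1 : q - 1 < m := by omega
  have e1 := h.head_id hq hz
  have e2 := h.tail_id_pred hq hq0 hz
  have e3 := h.head_le (q - 1) hq1
  have e4 := h.lt_tail q hq
  have e5 := h.tail_le q hq
  have hl (i : ℕ) (h1 : head (id (q - 1)) ≤ i) (h2 : i < q) : id i = id (q - 1) :=
    h.id_eq (q - 1) hq1 i h1 (by omega)
  have hr (i : ℕ) (h1 : q ≤ i) (h2 : i < tail (id q)) : id i = id q :=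
    h.id_eq q hq i (by omega) h2
  have hne (i : ℕ) (hi : i < m) (hc : ¬ (head (id (q - 1)) ≤ i ∧ i < tail (id q))) :
      id i ≠ id q := fun he => by
    have h1 := h.head_le i hi
    have h2 := h.lt_tail i hi
    rw [he] at h1 h2
    omega
  constructor
  · refine h.merge hq hq0 hz (h.id_lt _ hq) (by simp) rfl (fun i h1 h2 => ?_) fun i hi hc => ?_
    · split_ifs with h3
      · rfl
      · exact hr i (by omega) h2
    · rw [if_neg (by omega), Function.update_of_ne (hne i hi hc)]
      exact ⟨rfl, rfl, rfl⟩
  · refine potential_add_le (by omega) (fun i hi => ?_) (fun i h1 h2 => ?_)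
    · by_cases hc : head (id (q - 1)) ≤ i ∧ i < q
      · rw [if_pos hc, Function.update_self, hl i hc.1 hc.2]
        omega
      · rw [if_neg hc, Function.update_apply]
        split_ifs with h3
        · rw [h3]; omega
        · rfl
    · rw [if_pos ⟨h1, h2⟩, Function.update_self, hl i h1 h2]
      omega

/-- The bits of the blocks represent the set `D`, and the intervals begin at the nonempty blocks. -/
structure Blocks (width m : ℕ) (bits id head tail : ℕ → ℕ) (D : Finset ℕ) : Prop where
  bits_lt : ∀ i < m, bits i < 2 ^ width
  testBit_iff : ∀ i < m, ∀ r < width, (bits i).testBit r = true ↔ i * width + r ∈ D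
  intervals : Intervals m (fun i => bits i ≠ 0) id head tail

theorem div_mul_add_lt {u width m : ℕ} (hu : u < m * width) :
    u / width < m ∧ u % width < width ∧ u / width * width + u % width = u := by
  have hw : 0 < width := by
    rcases Nat.eq_zero_or_pos width with h | h
    · simp [h] at hu
    · exact h
  exact ⟨Nat.div_lt_of_lt_mul (by rwa [mul_comm]), Nat.mod_lt _ hw, Nat.div_add_mod' u width⟩

theorem block_eq {width q r q' r' : ℕ} (hr : r < width) (hr' : r' < width)
    (h : q * width + r = q' * width + r') : q = q' ∧ r = r' := by
  have h1 : (q * width + r) / width = q := by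
    rw [mul_comm, Nat.mul_add_div (by omega), Nat.div_eq_of_lt hr, add_zero]
  have h2 : (q' * width + r') / width = q' := by
    rw [mul_comm, Nat.mul_add_div (by omega), Nat.div_eq_of_lt hr', add_zero]
  have h3 : q = q' := by rw [← h1, h, h2]
  subst h3
  exact ⟨rfl, by omega⟩

/-- The bits after the removal of an element. -/
theorem Blocks.bits_erase {width m : ℕ} {bits id head tail : ℕ → ℕ} {D : Finset ℕ}
    (h : Blocks width m bits id head tail D) {u : ℕ} (hu : u < m * width) (huD : u ∈ D) :
    bits (u / width) ≠ 0 ∧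
    (∀ i < m, Function.update bits (u / width)
      (bits (u / width) ^^^ 2 ^ (u % width)) i < 2 ^ width) ∧
    ∀ i < m, ∀ r < width, (Function.update bits (u / width)
      (bits (u / width) ^^^ 2 ^ (u % width)) i).testBit r = true ↔ i * width + r ∈ D.erase u := by
  obtain ⟨h1, h2, h3⟩ := div_mul_add_lt hu
  have hb : (bits (u / width)).testBit (u % width) = true :=
    (h.testBit_iff _ h1 _ h2).2 (by rwa [h3])
  refine ⟨fun h0 => by simp [h0] at hb, fun i hi => ?_, fun i hi r hr => ?_⟩
  · rw [Function.update_apply]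
    split_ifs with hc
    · exact Nat.xor_lt_two_pow (h.bits_lt _ h1) (Nat.pow_lt_pow_right (by norm_num) h2)
    · exact h.bits_lt i hi
  · rw [Function.update_apply, Finset.mem_erase, ← h.testBit_iff i hi r hr]
    split_ifs with hc
    · subst hc
      rw [Nat.testBit_xor, Nat.testBit_two_pow]
      by_cases hrr : u % width = r
      · subst hrr
        simp [hb, h3]
      · have : u / width * width + r ≠ u := by omega
        simp [hrr, this]
    · have : i * width + r ≠ u := fun he => hc (block_eq hr h2 (he.trans h3.symm)).1
      simp [this]

/-- The predecessor lies in the block of `p`: it is the leading bit after masking off the bits above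
`p`. -/
theorem Blocks.pred_of_pos {width m : ℕ} {bits id head tail : ℕ → ℕ} {D : Finset ℕ}
    (h : Blocks width m bits id head tail D) {p x : ℕ} (hp : p < m * width)
    (hx : x = bits (p / width) % 2 ^ (p % width + 1)) (hx0 : 0 < x) :
    p / width * width + Nat.log 2 x ∈ D ∧ p / width * width + Nat.log 2 x ≤ p ∧
      ∀ y ∈ D, y ≤ p → y ≤ p / width * width + Nat.log 2 x := by
  obtain ⟨h1, h2, h3⟩ := div_mul_add_lt hp
  have hb := testBit_log_two hx0.ne'
  nth_rw 1 [hx] at hb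
  rw [Nat.testBit_mod_two_pow, Bool.and_eq_true, decide_eq_true_eq] at hb
  refine ⟨(h.testBit_iff _ h1 _ (by omega)).1 hb.2, by omega, fun y hy hyp => ?_⟩
  obtain ⟨h4, h5, h6⟩ := div_mul_add_lt (hyp.trans_lt hp)
  have h7 : y / width ≤ p / width := Nat.div_le_div_right hyp
  rcases h7.lt_or_eq with h8 | h8
  · have : (y / width + 1) * width ≤ p / width * width := Nat.mul_le_mul_right _ h8
    rw [add_mul] at this
    omega
  · rw [h8] at h6
    have : x.testBit (y % width) = true := by
      rw [hx, Nat.testBit_mod_two_pow, Bool.and_eq_true, decide_eq_true_eq]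
      exact ⟨by omega, (h.testBit_iff _ h1 _ h5).2 (by rwa [h6])⟩
    have := le_log_two_of_testBit this
    omega

/-- If the masked block of `p` is empty, the head of the interval containing the preceding block is
the nearest nonempty block to the left, and its leading bit is the predecessor. -/
theorem Blocks.pred_of_zero {width m : ℕ} {bits id head tail : ℕ → ℕ} {D : Finset ℕ}
    (h : Blocks width m bits id head tail D) (hD : 0 ∈ D) {p k : ℕ} (hp : p < m * width)
    (hx : bits (p / width) % 2 ^ (p % width + 1) = 0) (hk : k = head (id (p / width - 1))) :
    0 < p / width ∧ k * width + Nat.log 2 (bits k) ∈ D ∧ k * width + Nat.log 2 (bits k) ≤ p ∧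
      ∀ y ∈ D, y ≤ p → y ≤ k * width + Nat.log 2 (bits k) := by
  obtain ⟨h1, h2, h3⟩ := div_mul_add_lt hp
  have hno (r : ℕ) (hr : r ≤ p % width) : (bits (p / width)).testBit r = false := by
    have h4 : (bits (p / width) % 2 ^ (p % width + 1)).testBit r = false := by simp [hx]
    rwa [Nat.testBit_mod_two_pow, decide_eq_true (by omega), Bool.true_and] at h4
  -- The sentinel `0 ∈ D` keeps the masked block nonzero if `p` lies in the first block.
  have hpos : 0 < p / width := by
    by_contra hc
    have h0 : p / width = 0 := Nat.eq_zero_of_not_pos hc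
    have h4 := hno 0 (by omega)
    have h5 := (h.testBit_iff _ h1 0 (by omega)).2 (by simpa [h0] using hD)
    simp [h4] at h5
  have hm : p / width - 1 < m := by omega
  have hk1 := h.intervals.head_le _ hm
  rw [← hk] at hk1
  have hkz : bits k ≠ 0 := hk ▸ h.intervals.head_nz _ hm
  have hlt : Nat.log 2 (bits k) < width :=
    Nat.log_lt_of_lt_pow hkz (h.bits_lt k (by omega))
  have hle : (k + 1) * width ≤ p / width * width := Nat.mul_le_mul_right _ (by omega)
  rw [add_mul] at hle
  refine ⟨hpos, (h.testBit_iff k (by omega) _ hlt).1 (testBit_log_two hkz), by omega,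
    fun y hy hyp => ?_⟩
  obtain ⟨h4, h5, h6⟩ := div_mul_add_lt (hyp.trans_lt hp)
  have h7 : y / width ≤ p / width := Nat.div_le_div_right hyp
  have hyb : (bits (y / width)).testBit (y % width) = true :=
    (h.testBit_iff _ h4 _ h5).2 (by rwa [h6])
  have hyz : bits (y / width) ≠ 0 := fun h0 => by simp [h0] at hyb
  have h8 : y / width ≠ p / width := fun he => by
    rw [he] at h6 hyb
    rw [hno _ (by omega)] at hyb
    simp at hyb
  have h9 : y / width ≤ k := by
    by_contra hc
    have := h.intervals.lt_tail _ hm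
    exact h.intervals.not_nz _ hm (y / width) (by omega) (by omega) hyz
  rcases h9.lt_or_eq with h10 | h10
  · have : (y / width + 1) * width ≤ k * width := Nat.mul_le_mul_right _ h10
    rw [add_mul] at this
    omega
  · rw [h10] at h6 hyb
    have := le_log_two_of_testBit hyb
    omega

theorem blocks_init {width m : ℕ} {bits id head tail : ℕ → ℕ} (hw : 0 < width)
    (hb : ∀ i < m, bits i = 2 ^ width - 1) (hi : ∀ i < m, id i = i) (hh : ∀ i < m, head i = i)
    (ht : ∀ i < m, tail i = i + 1) :
    Blocks width m bits id head tail (Finset.range (m * width)) where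
  bits_lt i him := by rw [hb i him]; exact Nat.sub_lt (by positivity) one_pos
  testBit_iff i him r hr := by
    rw [hb i him, Nat.testBit_two_pow_sub_one, Finset.mem_range]
    have : (i + 1) * width ≤ m * width := Nat.mul_le_mul_right _ him
    rw [add_mul] at this
    simp only [hr, decide_true, true_iff]
    omega
  intervals := by
    constructor
    · intro i him; rwa [hi i him]
    · intro i him; rw [hi i him, hh i him]
    · intro i him; rw [hi i him, ht i him]; omega
    · intro i him; rw [hi i him, ht i him]; omega
    · intro i him i' h1 h2
      rw [hi i him, hh i him] at h1
      rw [hi i him, ht i him] at h2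
      rw [show i' = i by omega]
    · intro i him
      rw [hi i him, hh i him, hb i him]
      have := Nat.one_lt_two_pow hw.ne'
      omega
    · intro i him i' h1 h2
      rw [hi i him, hh i him] at h1
      rw [hi i him, ht i him] at h2
      omega

end WordRAM

namespace WordRAM

/-! ### The programs for deletion and predecessor search -/

@[simp] theorem State.setVar_v (s : State) (x y : Var) (a : ℕ) :
    (s.setVar x a).v y = if y = x then a else s.v y := by
  simp [State.setVar, Function.update_apply]

@[simp] theorem State.setVar_arr (s : State) (x : Var) (a : ℕ) : (s.setVar x a).arr = s.arr := rfl

@[simp] theorem State.setVar_inp (s : State) (x : Var) (a : ℕ) : (s.setVar x a).inp = s.inp := rfl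

@[simp] theorem State.setVar_out (s : State) (x : Var) (a : ℕ) : (s.setVar x a).out = s.out := rfl

@[simp] theorem State.setArr_v (s : State) (a : Arr) (i c : ℕ) : (s.setArr a i c).v = s.v := rfl

@[simp] theorem State.setArr_inp (s : State) (a : Arr) (i c : ℕ) :
    (s.setArr a i c).inp = s.inp := rfl

@[simp] theorem State.setArr_out (s : State) (a : Arr) (i c : ℕ) :
    (s.setArr a i c).out = s.out := rfl

@[simp] theorem State.setArr_arr (s : State) (a b : Arr) (i c : ℕ) :
    (s.setArr a i c).arr b = if b = a then Function.update (s.arr a) i c else s.arr b := by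
  simp [State.setArr, Function.update_apply]

attribute [simp] Op.eval

infixr:60 " ;; " => Cmd.seq

/-- Increase a variable by one. -/
abbrev Cmd.incr (x : Var) : Cmd := .assign x (.bin .add (.var x) (.lit 1))

/-- Give the name in `x` to the numbers from `idx` up to `y`. -/
def relabel (x y : Var) : Cmd :=
  .loop (.var .idx) (.var y) (.put .id (.var .idx) (.var x) ;; .incr .idx)

theorem relabel_spec {M : ℕ} {x y : Var} {s : State} (hx : x ≠ .idx) (hy : y ≠ .idx)
    (hM : 24 * s.v y + 50 ≤ M) (hle : s.v .idx ≤ s.v y) :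
    ∃ s' t, Exec M (relabel x y) s s' t ∧
      s'.arr .id = (fun i => if s.v .idx ≤ i ∧ i < s.v y then s.v x else s.arr .id i) ∧
      t ≤ 20 * (s.v y - s.v .idx) + 4 := by
  refine Cmd.exists_exec_of_wp (wp_loop (i := s.v .idx) (N := s.v y)
    (fun i σ t => σ.v .idx = i ∧ σ.v x = s.v x ∧ σ.v y = s.v y ∧ s.v .idx ≤ i ∧
      (∀ k, σ.arr .id k = if s.v .idx ≤ k ∧ k < i then s.v x else s.arr .id k) ∧
      t ≤ 20 * (i - s.v .idx)) ?_ hle ?_ ?_)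
  · simp
  · rintro i σ t hi ⟨h1, h2, h3, h4, h5, h6⟩
    simp [h1, h2, h3, hx, hy]
    refine ⟨hi, by omega, by omega, by omega, fun k => ?_, by omega⟩
    rw [Function.update_apply, h5]
    split_ifs <;> first | rfl | omega
  · rintro σ t ⟨h1, h2, h3, h4, h5, h6⟩
    refine ⟨by simp [h1, h3], funext h5, by simp; omega⟩

/-- Merge the interval that begins with the block `blk` into its left neighbour, relabelling the
shorter of the two. -/
def mergeLeft : Cmd :=
  .assign .seg (.get .id (.var .blk)) ;;
  .assign .lseg (.get .id (.bin .sub (.var .blk) (.lit 1))) ;;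
  .assign .bound (.get .tail (.var .seg)) ;;
  .cond (.bin .sub (.var .blk) (.get .head (.var .lseg))) (.bin .sub (.var .bound) (.var .blk))
    (.assign .idx (.get .head (.var .lseg)) ;;
      .put .head (.var .seg) (.var .idx) ;; relabel .seg .blk)
    (.assign .idx (.var .blk) ;; .put .tail (.var .lseg) (.var .bound) ;; relabel .lseg .bound)

/-- The potential of the intervals in the memory. -/
def State.potential (s : State) : ℕ :=
  WordRAM.potential (s.v .blocks) (s.arr .id) (s.arr .head) (s.arr .tail)

/-- Amortized running time: a round of `relabel` costs at most `20`, and the potential grows by at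
least the number of rounds. -/
theorem mergeLeft_spec {M : ℕ} {s : State} {nz : ℕ → Prop}
    (h : Intervals (s.v .blocks) nz (s.arr .id) (s.arr .head) (s.arr .tail))
    (hq : s.v .blk < s.v .blocks) (hq0 : 0 < s.v .blk) (hz : nz (s.v .blk))
    (hM : 24 * s.v .blocks + 50 ≤ M) :
    ∃ s' t, Exec M mergeLeft s s' t ∧
      Intervals (s'.v .blocks) (fun i => nz i ∧ i ≠ s.v .blk) (s'.arr .id) (s'.arr .head)
        (s'.arr .tail) ∧
      t + 20 * s.potential ≤ 20 * s'.potential + 60 := by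
  have e2 := h.tail_id_pred hq hq0 hz
  have e3 := h.head_le (s.v .blk - 1) (by omega)
  have e4 := h.lt_tail _ hq
  have e5 := h.tail_le _ hq
  have e6 := h.id_lt _ hq
  have e7 := h.id_lt (s.v .blk - 1) (by omega)
  suffices hw : mergeLeft.wp M (fun s' t => s'.v .blocks = s.v .blocks →
      Intervals (s'.v .blocks) (fun i => nz i ∧ i ≠ s.v .blk) (s'.arr .id) (s'.arr .head)
        (s'.arr .tail) ∧
      t + 20 * s.potential ≤ 20 * s'.potential + 60) s by
    obtain ⟨s', t, hx, hQ⟩ := Cmd.exists_exec_of_wp hw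
    exact ⟨s', t, hx, hQ (hx.var_eq (by decide))⟩
  simp [mergeLeft]
  refine ⟨by omega, ⟨by omega, by omega⟩, by omega, by omega, by omega, fun hlt => ?_,
    fun hlt => ?_⟩
  · refine ⟨by omega, by omega, ?_⟩
    obtain ⟨h1, h2⟩ := h.merge_right hq hq0 hz (by omega)
    set s1 := ((((s.setVar .seg (s.arr .id (s.v .blk))).setVar .lseg
      (s.arr .id (s.v .blk - 1))).setVar .bound (s.arr .tail (s.arr .id (s.v .blk)))).setVar .idx
      (s.arr .head (s.arr .id (s.v .blk - 1)))).setArr .head (s.arr .id (s.v .blk))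
      (s.arr .head (s.arr .id (s.v .blk - 1))) with hs1
    obtain ⟨s', t, hx, hid, ht⟩ := relabel_spec (M := M) (x := .seg) (y := .blk) (s := s1)
      (by decide) (by decide) (by simp [hs1]; omega) (by simp [hs1]; omega)
    have a1 : s'.arr .head = s1.arr .head := hx.arr_eq (by decide)
    have a2 : s'.arr .tail = s1.arr .tail := hx.arr_eq (by decide)
    refine hx.wp fun hb => ?_
    simp [hs1] at hid ht a1 a2
    unfold State.potential
    rw [hid, a1, a2, hb]
    refine ⟨h1, by omega⟩
  · refine ⟨by omega, ?_⟩
    obtain ⟨h1, h2⟩ := h.merge_left hq hq0 hz (by omega)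
    set s1 := ((((s.setVar .seg (s.arr .id (s.v .blk))).setVar .lseg
      (s.arr .id (s.v .blk - 1))).setVar .bound (s.arr .tail (s.arr .id (s.v .blk)))).setVar .idx
      (s.v .blk)).setArr .tail (s.arr .id (s.v .blk - 1))
      (s.arr .tail (s.arr .id (s.v .blk))) with hs1
    obtain ⟨s', t, hx, hid, ht⟩ := relabel_spec (M := M) (x := .lseg) (y := .bound) (s := s1)
      (by decide) (by decide) (by simp [hs1]; omega) (by simp [hs1]; omega)
    have a1 : s'.arr .head = s1.arr .head := hx.arr_eq (by decide)
    have a2 : s'.arr .tail = s1.arr .tail := hx.arr_eq (by decide)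
    refine hx.wp fun hb => ?_
    simp [hs1] at hid ht a1 a2
    unfold State.potential
    rw [hid, a1, a2, hb]
    refine ⟨h1, by omega⟩

/-- Delete the element `tok`. -/
def deleteTok : Cmd :=
  .assign .blk (.bin .div (.var .tok) (.var .width)) ;;
  .put .bits (.var .blk) (.bin .xor (.get .bits (.var .blk))
    (.bin .shl (.lit 1) (.bin .mod (.var .tok) (.var .width)))) ;;
  .cond (.get .bits (.var .blk)) (.lit 1) mergeLeft .skip

/-- The blocks in the memory represent `D`. -/
def State.Stores (s : State) (D : Finset ℕ) : Prop :=
  Blocks (s.v .width) (s.v .blocks) (s.arr .bits) (s.arr .id) (s.arr .head) (s.arr .tail) D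

theorem deleteTok_spec {M : ℕ} {s : State} {D : Finset ℕ} (h : s.Stores D) (hD : 0 ∈ D)
    (hu : s.v .tok ∈ D) (hu0 : s.v .tok ≠ 0) (hlt : s.v .tok < s.v .blocks * s.v .width)
    (hM : 24 * s.v .blocks + 50 ≤ M) (hM' : 2 * 2 ^ s.v .width ≤ M) :
    ∃ s' t, Exec M deleteTok s s' t ∧ s'.Stores (D.erase (s.v .tok)) ∧
      t + 20 * s.potential ≤ 20 * s'.potential + 120 := by
  obtain ⟨h1, h2, h3⟩ := div_mul_add_lt hlt
  obtain ⟨b0, b1, b2⟩ := h.bits_erase hlt hu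
  have hpow : 2 ^ (s.v .tok % s.v .width) < 2 ^ s.v .width :=
    Nat.pow_lt_pow_right (by norm_num) h2
  have hwlt : s.v .width < 2 ^ s.v .width := Nat.lt_two_pow_self
  have b3 := b1 _ h1
  rw [Function.update_self] at b3
  suffices hw : deleteTok.wp M (fun s' t => s'.v .blocks = s.v .blocks → s'.v .width = s.v .width →
      s'.Stores (D.erase (s.v .tok)) ∧ t + 20 * s.potential ≤ 20 * s'.potential + 120) s by
    obtain ⟨s', t, hx, hQ⟩ := Cmd.exists_exec_of_wp hw
    exact ⟨s', t, hx, hQ (hx.var_eq (by decide)) (hx.var_eq (by decide))⟩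
  simp [deleteTok, Nat.one_shiftLeft]
  generalize hq : s.v .tok / s.v .width = q at *
  generalize hr : s.v .tok % s.v .width = r at *
  refine ⟨by omega, ⟨by omega, by omega, b3.trans_le (by omega)⟩, by omega, by omega,
    fun h0 => ?_, fun h0 => ?_⟩
  · set s1 := (s.setVar .blk q).setArr .bits q (s.arr .bits q ^^^ 2 ^ r) with hs1
    -- The first block always holds the sentinel `0`, which is not the deleted token; so an emptied
    -- block has a left neighbour.
    have hq0 : 0 < q := by
      by_contra hc
      obtain rfl : q = 0 := by omega
      have h4 := (b2 0 h1 0 (by omega)).2 (by simp [hu0.symm, hD])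
      rw [Function.update_self, h0] at h4
      simp at h4
    obtain ⟨s', t, hx, hI, ht⟩ := mergeLeft_spec (M := M) (s := s1)
      (nz := fun i => s.arr .bits i ≠ 0)
      (by simpa [hs1] using h.intervals) (by simpa [hs1] using h1) (by simpa [hs1] using hq0)
      (by simpa [hs1] using b0) (by simpa [hs1] using hM)
    have a1 : s'.arr .bits = s1.arr .bits := hx.arr_eq (by decide)
    refine hx.wp fun hb hwid => ?_
    have hp : s1.potential = s.potential := by simp [hs1, State.potential]
    simp [hs1] at a1
    refine ⟨⟨?_, ?_, hI.congr fun i hi => ?_⟩, by omega⟩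
    · rw [hb, hwid, a1]; exact b1
    · rw [hb, hwid, a1]; exact b2
    · rw [a1, Function.update_apply]
      by_cases hc : i = q <;> simp [hs1, hc, h0]
  · refine ⟨⟨?_, ?_, ?_⟩, ?_⟩
    · simpa using b1
    · simpa using b2
    · refine (show Intervals _ _ _ _ _ from h.intervals).congr fun i hi => ?_
      simp only [State.setArr_arr, if_true, State.setVar_arr, Function.update_apply]
      by_cases hc : i = q
      · simp [hc, h0, b0]
      · simp [hc]
    · simp [State.potential]
      omega

/-- Find the greatest element up to `prev[pos]`. -/
def findTok : Cmd :=
  .assign .tok (.get .prev (.var .pos)) ;;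
  .assign .blk (.bin .div (.var .tok) (.var .width)) ;;
  .assign .acc (.bin .mod (.get .bits (.var .blk))
    (.bin .shl (.lit 2) (.bin .mod (.var .tok) (.var .width)))) ;;
  .cond (.lit 0) (.var .acc)
    (.assign .tok (.bin .add (.bin .mul (.var .blk) (.var .width)) (.get .msb (.var .acc))))
    (.assign .blk (.get .head (.get .id (.bin .sub (.var .blk) (.lit 1)))) ;;
      .assign .tok (.bin .add (.bin .mul (.var .blk) (.var .width))
        (.get .msb (.get .bits (.var .blk)))))

theorem findTok_spec {M : ℕ} {s : State} {D : Finset ℕ} (h : s.Stores D) (hD : 0 ∈ D)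
    (hp : s.arr .prev (s.v .pos) < s.v .blocks * s.v .width) (hM : 24 * s.v .blocks + 50 ≤ M)
    (hM' : 30 * 2 ^ s.v .width ≤ M) (hpM : 24 * s.v .pos + 50 ≤ M)
    (hpM' : s.arr .prev (s.v .pos) < M)
    (hmsb : ∀ x < 2 ^ s.v .width, s.arr .msb x = Nat.log 2 x) :
    ∃ s' t, Exec M findTok s s' t ∧ s'.v .tok ∈ D ∧ s'.v .tok ≤ s.arr .prev (s.v .pos) ∧
      (∀ y ∈ D, y ≤ s.arr .prev (s.v .pos) → y ≤ s'.v .tok) ∧ t ≤ 100 := by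
  obtain ⟨h1, h2, h3⟩ := div_mul_add_lt hp
  have hwlt : s.v .width < 2 ^ s.v .width := Nat.lt_two_pow_self
  have hb := h.bits_lt _ h1
  have f1 := h.pred_of_pos hp rfl
  have f2 := h.pred_of_zero hD hp (k := _) (hk := rfl)
  apply Cmd.exists_exec_of_wp
  simp [findTok, Nat.shiftLeft_eq, ← pow_succ']
  generalize s.arr .prev (s.v .pos) = p at *
  have hpow : 2 ^ (p % s.v .width + 1) ≤ 2 ^ s.v .width :=
    Nat.pow_le_pow_right (by norm_num) (by omega)
  generalize hq : p / s.v .width = q at *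
  generalize hr : p % s.v .width = r at *
  have hmod : s.arr .bits q % 2 ^ (r + 1) ≤ s.arr .bits q := Nat.mod_le _ _
  generalize hx : s.arr .bits q % 2 ^ (r + 1) = x at *
  refine ⟨by omega, by omega, ⟨by omega, ⟨by omega, by omega, by omega⟩, by omega⟩, by omega,
    fun hx0 => ?_, fun hx0 => ?_⟩
  · obtain ⟨g1, g2, g3⟩ := f1 hx0
    rw [hmsb x (by omega)]
    exact ⟨⟨by omega, by omega, by omega⟩, g1, g2, g3⟩
  · obtain ⟨g0, g1, g2, g3⟩ := f2 hx0
    have i1 := h.intervals.id_lt (q - 1) (by omega)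
    have i2 := h.intervals.head_le (q - 1) (by omega)
    have i3 := h.bits_lt (s.arr .head (s.arr .id (q - 1))) (by omega)
    rw [hmsb _ i3]
    refine ⟨⟨⟨⟨by omega, by omega⟩, by omega⟩, by omega⟩, ⟨by omega, ⟨by omega, by omega⟩, by omega⟩,
      g1, g2, g3⟩

end WordRAM

namespace WordRAM

open Words

/-! ### One layer of the dynamic program -/

/-- The part of the memory that stays fixed during the dynamic program for `w`. -/
structure Env {σ : ℕ} (w : List (Fin σ)) (s : State) : Prop where
  len : s.v .len = w.length
  width : s.v .width = Nat.size w.length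
  base : s.v .base = 2 ^ Nat.size w.length
  blocks : s.v .blocks = w.length / Nat.size w.length + 1
  prev : ∀ j (hj : j < w.length), s.arr .prev (j + 1) = lastOcc w j w[j]
  msb : ∀ x < 2 ^ Nat.size w.length, s.arr .msb x = Nat.log 2 x

/-- The command changes nothing that `Env` refers to. -/
def Cmd.keepsEnv (c : Cmd) : Bool :=
  !(c.setsVar .len || c.setsVar .width || c.setsVar .base || c.setsVar .blocks ||
    c.setsArr .prev || c.setsArr .msb)

theorem Env.frame {σ : ℕ} {w : List (Fin σ)} {M : ℕ} {c : Cmd} {s s' : State} {t : ℕ}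
    (h : Env w s) (hx : Exec M c s s' t) (hc : c.keepsEnv = true) : Env w s' := by
  simp only [Cmd.keepsEnv, Bool.not_eq_true', Bool.or_eq_false_iff] at hc
  obtain ⟨⟨⟨⟨⟨h1, h2⟩, h3⟩, h4⟩, h5⟩, h6⟩ := hc
  constructor
  · rw [hx.var_eq h1, h.len]
  · rw [hx.var_eq h2, h.width]
  · rw [hx.var_eq h3, h.base]
  · rw [hx.var_eq h4, h.blocks]
  · rw [hx.arr_eq h5]; exact h.prev
  · rw [hx.arr_eq h6]; exact h.msb

theorem lt_two_pow_size (n : ℕ) : n < 2 ^ Nat.size n := Nat.lt_size_self n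

theorem size_le_self (n : ℕ) : Nat.size n ≤ n := Nat.size_le.2 Nat.lt_two_pow_self

theorem lt_blocks_mul {n : ℕ} (hn : 0 < n) : n < (n / Nat.size n + 1) * Nat.size n := by
  have h : 0 < Nat.size n := Nat.size_pos.2 hn
  rw [mul_comm]
  exact Nat.lt_mul_div_succ n h

theorem Env.lt_blocks {σ : ℕ} {w : List (Fin σ)} {s : State} (h : Env w s) (hw : 0 < w.length) :
    w.length < s.v .blocks * s.v .width := by
  rw [h.blocks, h.width]
  exact lt_blocks_mul hw

theorem Env.blocks_le {σ : ℕ} {w : List (Fin σ)} {s : State} (h : Env w s) :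
    s.v .blocks ≤ w.length + 1 := by
  rw [h.blocks]
  have := Nat.div_le_self w.length (Nat.size w.length)
  omega

/-- `c` tells whether the value of `t` factors stays the same at position `x + 1`. -/
def KeepOk {σ : ℕ} (w : List (Fin σ)) (t x c : ℕ) : Prop :=
  bestSum w t (x + 1) + c = bestSum w t x + 1 ∧ c ≤ 1

/-- The invariant of a layer after `j` positions. -/
structure LayerInv {σ : ℕ} (w : List (Fin σ)) (t j : ℕ) (s : State) : Prop where
  env : Env w s
  pos : s.v .pos = j + 1
  stores : ∃ D, s.Stores D ∧ 0 ∈ D ∧ (∀ x, j < x → x ≤ w.length → x ∈ D) ∧ TokenInv w t j D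
  done : ∀ x < j, KeepOk w (t + 1) x (s.arr .keep (x + 1))
  rest : ∀ x, j ≤ x → x < w.length → KeepOk w t x (s.arr .keep (x + 1))

/-- Remove the position `pos` from the tokens unless it is marked. -/
def dropPos : Cmd :=
  .cond (.get .keep (.var .pos)) (.lit 1) (.assign .tok (.var .pos) ;; deleteTok) .skip

/-- Use up the token `tok`, if there is one, and mark `pos` accordingly. -/
def useTok : Cmd :=
  .cond (.lit 0) (.var .tok) (deleteTok ;; .put .keep (.var .pos) (.lit 1))
    (.put .keep (.var .pos) (.lit 0))

def layerStep : Cmd := dropPos ;; findTok ;; useTok ;; .incr .pos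

theorem dropPos_spec {M : ℕ} {s : State} {D : Finset ℕ} (h : s.Stores D) (hD : 0 ∈ D)
    (hp : s.v .pos ∈ D) (hp0 : s.v .pos ≠ 0) (hlt : s.v .pos < s.v .blocks * s.v .width)
    (hM : 24 * s.v .blocks + 50 ≤ M) (hM' : 2 * 2 ^ s.v .width ≤ M)
    (hpM : 24 * s.v .pos + 50 ≤ M) :
    ∃ s' t, Exec M dropPos s s' t ∧
      s'.Stores (if s.arr .keep (s.v .pos) = 0 then D.erase (s.v .pos) else D) ∧
      t + 20 * s.potential ≤ 20 * s'.potential + 140 := by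
  apply Cmd.exists_exec_of_wp
  simp [dropPos]
  refine ⟨by omega, by omega, fun h0 => ?_, fun h0 => ?_⟩
  · obtain ⟨s', t, hx, h1, h2⟩ := deleteTok_spec (M := M) (s := s.setVar .tok (s.v .pos)) (D := D)
      (by simpa [State.Stores] using h) hD (by simpa using hp) (by simpa using hp0)
      (by simpa using hlt) (by simpa using hM) (by simpa using hM')
    refine hx.wp ?_
    simp [State.potential] at h1 h2 ⊢
    rw [if_pos h0]
    exact ⟨h1, by omega⟩
  · rw [if_neg h0]
    exact ⟨h, by omega⟩

theorem useTok_spec {M : ℕ} {s : State} {D : Finset ℕ} (h : s.Stores D) (hD : 0 ∈ D)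
    (hu : s.v .tok ∈ D) (hlt : s.v .tok < s.v .blocks * s.v .width)
    (hM : 24 * s.v .blocks + 50 ≤ M) (hM' : 2 * 2 ^ s.v .width ≤ M)
    (hpM : 24 * s.v .pos + 50 ≤ M) :
    ∃ s' t, Exec M useTok s s' t ∧
      s'.Stores (if s.v .tok = 0 then D else D.erase (s.v .tok)) ∧
      s'.arr .keep = Function.update (s.arr .keep) (s.v .pos) (if s.v .tok = 0 then 0 else 1) ∧
      t + 20 * s.potential ≤ 20 * s'.potential + 140 := by
  apply Cmd.exists_exec_of_wp
  simp [useTok]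
  refine ⟨by omega, fun h0 => ?_, fun h0 => ?_⟩
  · obtain ⟨s', t, hx, h1, h2⟩ := deleteTok_spec (M := M) h hD hu (by omega) hlt hM hM'
    have a1 : s'.v .pos = s.v .pos := hx.var_eq (by decide)
    have a2 : s'.arr .keep = s.arr .keep := hx.arr_eq (by decide)
    refine hx.wp ?_
    simp [State.potential, State.Stores, a1, a2, Nat.pos_iff_ne_zero.1 h0] at h1 h2 ⊢
    refine ⟨by omega, by omega, h1, by omega⟩
  · simp [State.potential, State.Stores, h0]
    exact ⟨by omega, by omega, h, by omega⟩

/-- The array `keep` is overwritten in place: the entry of layer `t` at position `j + 1` is read by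
`dropPos` before `useTok` replaces it by that of layer `t + 1`. The program follows `TokenInv.step`,
with `u` the predecessor of `lastOcc w j w[j]`. -/
theorem layerStep_spec {σ : ℕ} {w : List (Fin σ)} {M t j : ℕ} {s : State}
    (h : LayerInv w t j s) (hj : j < w.length) (hM : 1000 * 2 ^ Nat.size w.length ≤ M) :
    ∃ s' τ, Exec M layerStep s s' τ ∧ LayerInv w t (j + 1) s' ∧
      τ + 20 * s.potential ≤ 20 * s'.potential + 500 := by
  obtain ⟨henv, hpos, ⟨D, hS, hD0, hDr, hT⟩, hdone, hrest⟩ := h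
  have hn := lt_two_pow_size w.length
  have hbl := henv.lt_blocks (by omega)
  have hbl' := henv.blocks_le
  have hwid := henv.width
  obtain ⟨hk1, hk2⟩ := hrest j le_rfl hj
  have hlast := lastOcc_le w j w[j]
  -- the token at the new position
  obtain ⟨s1, t1, x1, S1, p1⟩ := dropPos_spec (M := M) hS hD0
    (by rw [hpos]; exact hDr _ (by omega) (by omega)) (by omega) (by omega) (by omega)
    (by rw [hwid]; omega) (by omega)
  have henv1 := henv.frame x1 (by decide)
  have hpos1 : s1.v .pos = j + 1 := by rw [x1.var_eq (by decide), hpos]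
  have hkeep1 : s1.arr .keep = s.arr .keep := x1.arr_eq (by decide)
  have hbl1 := henv1.lt_blocks (by omega)
  have hbl1' := henv1.blocks_le
  rw [hpos] at S1
  set D1 := if s.arr .keep (j + 1) = 0 then D.erase (j + 1) else D with hD1
  have hD1sub (x : ℕ) (hx : x ∈ D) (hxj : x ≠ j + 1) : x ∈ D1 := by
    rw [hD1]; split_ifs
    · exact Finset.mem_erase.2 ⟨hxj, hx⟩
    · exact hx
  have hD10 := hD1sub 0 hD0 (by omega)
  -- the search
  have hprev1 : s1.arr .prev (s1.v .pos) = lastOcc w j w[j] := by rw [hpos1, henv1.prev j hj]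
  obtain ⟨s2, t2, x2, f1, f2, f3, ht2⟩ := findTok_spec (M := M) S1 hD10 (by omega) (by omega)
    (by rw [henv1.width]; omega) (by omega) (by omega) (by rw [henv1.width]; exact henv1.msb)
  rw [hprev1] at f2 f3
  have henv2 := henv1.frame x2 (by decide)
  have hpos2 : s2.v .pos = j + 1 := by rw [x2.var_eq (by decide), hpos1]
  have hkeep2 : s2.arr .keep = s.arr .keep := by rw [x2.arr_eq (by decide), hkeep1]
  have hbl2 := henv2.lt_blocks (by omega)
  have hbl2' := henv2.blocks_le
  have hid2 : s2.arr .id = s1.arr .id := x2.arr_eq (by decide)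
  have hhead2 : s2.arr .head = s1.arr .head := x2.arr_eq (by decide)
  have htail2 : s2.arr .tail = s1.arr .tail := x2.arr_eq (by decide)
  have hbits2 : s2.arr .bits = s1.arr .bits := x2.arr_eq (by decide)
  have hblk2 : s2.v .blocks = s1.v .blocks := x2.var_eq (by decide)
  have hwid2 : s2.v .width = s1.v .width := x2.var_eq (by decide)
  have S2 : s2.Stores D1 := by
    rw [State.Stores, hid2, hhead2, htail2, hbits2, hblk2, hwid2]; exact S1
  have p2 : s2.potential = s1.potential := by
    rw [State.potential, hid2, hhead2, htail2, hblk2]; rfl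
  -- the use of the token
  obtain ⟨s3, t3, x3, S3, k3, p3⟩ := useTok_spec (M := M) S2 hD10 f1 (by omega) (by omega)
    (by rw [henv2.width]; omega) (by omega)
  have henv3 := henv2.frame x3 (by decide)
  have hpos3 : s3.v .pos = j + 1 := by rw [x3.var_eq (by decide), hpos2]
  rw [hpos2, hkeep2] at k3
  have x4 : Exec M (.incr .pos) s3 _ _ := .assign (M := M) (s := s3) (x := .pos)
    (e := .bin .add (.var .pos) (.lit 1)) (by simp [hpos3]; omega)
  obtain ⟨hT', hv⟩ := hT.step hj hk1 (hDr _ (by omega) (by omega)) hk2 hD1 f2 f1 f3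
  refine ⟨_, _, .seq x1 (.seq x2 (.seq x3 x4)), ⟨henv3.frame x4 (by decide), by simp [hpos3],
    ⟨_, S3, ?_, ?_, hT'⟩, ?_, ?_⟩, ?_⟩
  · split_ifs with h0
    · exact hD10
    · exact Finset.mem_erase.2 ⟨Ne.symm h0, hD10⟩
  · intro x hx hxn
    have := hD1sub x (hDr x (by omega) hxn) (by omega)
    split_ifs with h0
    · exact this
    · exact Finset.mem_erase.2 ⟨by omega, this⟩
  · intro x hx
    rw [State.setVar_arr, k3, Function.update_apply]
    split_ifs with hc h0
    · obtain rfl : x = j := by omega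
      exact ⟨by rw [← hv, if_pos h0], by omega⟩
    · obtain rfl : x = j := by omega
      exact ⟨by rw [← hv, if_neg h0], by omega⟩
    · exact hdone x (by omega)
  · intro x hx hxn
    rw [State.setVar_arr, k3, Function.update_of_ne (by omega)]
    exact hrest x (by omega) hxn
  · have p4 : (s3.setVar .pos (Expr.val s3 (.bin .add (.var .pos) (.lit 1)))).potential =
        s3.potential := by simp [State.potential]
    rw [p4]
    simp
    omega

/-- Make all blocks full. -/
def initBlocks : Cmd :=
  .assign .idx (.lit 0) ;;
  .loop (.var .idx) (.var .blocks)
    (.put .bits (.var .idx) (.bin .sub (.var .base) (.lit 1)) ;;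
      .put .id (.var .idx) (.var .idx) ;; .put .head (.var .idx) (.var .idx) ;;
      .put .tail (.var .idx) (.bin .add (.var .idx) (.lit 1)) ;; .incr .idx)

theorem initBlocks_spec {M : ℕ} {s : State} (hw : 0 < s.v .width)
    (hb : s.v .base = 2 ^ s.v .width) (hM : 24 * s.v .blocks + 50 ≤ M) (hM' : s.v .base < M) :
    ∃ s' t, Exec M initBlocks s s' t ∧
      s'.Stores (Finset.range (s.v .blocks * s.v .width)) ∧ t ≤ 60 * s.v .blocks + 10 := by
  apply Cmd.exists_exec_of_wp
  simp only [initBlocks, Cmd.wp]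
  refine ⟨by simp; omega, wp_loop (i := 0) (N := s.v .blocks) (fun i σ t => σ.v .idx = i ∧
    σ.v .blocks = s.v .blocks ∧ σ.v .base = s.v .base ∧ σ.v .width = s.v .width ∧
    (∀ k < i, σ.arr .bits k = s.v .base - 1) ∧ (∀ k < i, σ.arr .id k = k) ∧
    (∀ k < i, σ.arr .head k = k) ∧ (∀ k < i, σ.arr .tail k = k + 1) ∧ t ≤ 60 * i)
    ?_ (Nat.zero_le _) ?_ ?_⟩
  · simp
  · rintro i σ t hi ⟨h1, h2, h3, h4, h5, h6, h7, h8, h9⟩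
    simp [h1, h2, h3, h4, Function.update_apply]
    refine ⟨hi, ⟨by omega, by omega⟩, by omega, by omega, by omega, by omega, ?_, ?_, ?_, ?_,
      by omega⟩
    all_goals
      intro k hk
      by_cases hc : k = i
      · simp [hc]
      · have hki : k < i := by omega
        simp [hc, h5 k hki, h6 k hki, h7 k hki, h8 k hki]
  · rintro σ t ⟨h1, h2, h3, h4, h5, h6, h7, h8, h9⟩
    refine ⟨by simp [h1, h2], ?_, by simp; omega⟩
    rw [State.Stores, h2, h4]
    exact blocks_init hw (by rw [← hb]; exact h5) h6 h7 h8

/-- One layer of the dynamic program. -/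
def layer : Cmd :=
  initBlocks ;; .assign .pos (.lit 1) ;;
  .loop (.var .pos) (.bin .add (.var .len) (.lit 1)) layerStep

/-- The amortized costs telescope, so a layer costs `O(n)` plus a multiple of the final potential.
-/
theorem layer_spec {σ : ℕ} {w : List (Fin σ)} {M t : ℕ} {s : State} (henv : Env w s)
    (hw : 0 < w.length) (hM : 1000 * 2 ^ Nat.size w.length ≤ M)
    (hk : ∀ x < w.length, KeepOk w t x (s.arr .keep (x + 1))) :
    ∃ s' τ, Exec M layer s s' τ ∧ Env w s' ∧
      (∀ x < w.length, KeepOk w (t + 1) x (s'.arr .keep (x + 1))) ∧ τ ≤ 1000 * w.length := by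
  have hn := lt_two_pow_size w.length
  have hbl' := henv.blocks_le
  have hwid : 0 < Nat.size w.length := Nat.size_pos.2 hw
  obtain ⟨s1, t1, x1, S1, ht1⟩ := initBlocks_spec (M := M) (s := s) (by rw [henv.width]; exact hwid)
    (by rw [henv.base, henv.width]) (by omega) (by rw [henv.base]; omega)
  have henv1 := henv.frame x1 (by decide)
  have hkeep1 : s1.arr .keep = s.arr .keep := x1.arr_eq (by decide)
  have hblk1 : s1.v .blocks = s.v .blocks := x1.var_eq (by decide)
  have hwid1 : s1.v .width = s.v .width := x1.var_eq (by decide)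
  have hbl := henv.lt_blocks hw
  set s2 := s1.setVar .pos 1 with hs2
  have x2 : Exec M (.assign .pos (.lit 1)) s1 s2 2 := .assign (e := .lit 1) (by simp; omega)
  have hinv : LayerInv w t 0 s2 := by
    refine ⟨henv1.frame x2 (by decide), by simp [hs2], ⟨_, S1, ?_, ?_, tokenInv_zero _ _ _⟩, ?_, ?_⟩
    · rw [Finset.mem_range]; omega
    · intro x hx hxn; rw [Finset.mem_range]; omega
    · intro x hx; omega
    · intro x _ hx
      rw [hs2, State.setVar_arr, hkeep1]
      exact hk x hx
  have hwp : (Cmd.loop (.var .pos) (.bin .add (.var .len) (.lit 1)) layerStep).wp M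
      (fun s' τ => LayerInv w t w.length s' ∧ τ ≤ 510 * w.length + 20 * s'.potential + 10) s2 := by
    refine wp_loop (i := 0) (N := w.length)
      -- The `500` of a step and the `6` of the loop test stay below `510`.
      (fun j σ τ => LayerInv w t j σ ∧ τ ≤ 510 * j + 20 * σ.potential) ⟨hinv, by omega⟩
      (Nat.zero_le _) ?_ ?_
    · rintro j σ τ hj ⟨hI, hτ⟩
      have h1 := hI.env.len
      have h2 := hI.pos
      obtain ⟨s', τ', hx, hI', hτ'⟩ := layerStep_spec hI hj hM
      refine ⟨trivial, by simp [h1]; omega, by simp [h1, h2]; omega, hx.wp ⟨hI', ?_⟩⟩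
      simp
      omega
    · rintro σ τ ⟨hI, hτ⟩
      have h1 := hI.env.len
      have h2 := hI.pos
      refine ⟨⟨trivial, by simp [h1]; omega, by simp [h1, h2]⟩, hI, ?_⟩
      simp
      omega
  obtain ⟨s3, t3, x3, hI, ht3⟩ := Cmd.exists_exec_of_wp hwp
  obtain ⟨D, hS, -⟩ := hI.stores
  -- With `m = n / width + 1` blocks and `log m ≤ width`, the bound `m log m` is at most `n + width
  -- ≤ 2n`. This is where blocks of logarithmic length remove the logarithmic factor.
  have hpot : s3.potential ≤ 2 * w.length := by
    refine hS.intervals.potential_le.trans ?_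
    rw [hI.env.blocks]
    have h1 := size_le_self w.length
    have h2 : Nat.log 2 (w.length / Nat.size w.length + 1) ≤ Nat.size w.length := by
      refine (Nat.log_mono_right (b := 2) (m := 2 ^ Nat.size w.length) ?_).trans
        (Nat.log_pow (by norm_num) _).le
      have := Nat.div_le_self w.length (Nat.size w.length)
      omega
    have h3 := Nat.div_mul_le_self w.length (Nat.size w.length)
    calc _ ≤ (w.length / Nat.size w.length + 1) * Nat.size w.length := Nat.mul_le_mul_left _ h2
      _ ≤ _ := by rw [add_mul]; omega
  exact ⟨s3, _, .seq x1 (.seq x2 x3), hI.env, hI.done, by omega⟩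

end WordRAM

namespace WordRAM

open Words

/-! ### Reading the input -/

def readWord : Cmd :=
  .read .len .flag ;; .read .sig .flag ;;
  .loop (.var .pos) (.var .len)
    (.read .limb .flag ;;
      .put .prev (.bin .add (.var .pos) (.lit 1)) (.get .last (.var .limb)) ;;
      .put .last (.var .limb) (.bin .add (.var .pos) (.lit 1)) ;;
      .put .keep (.bin .add (.var .pos) (.lit 1)) (.lit 1) ;; .incr .pos)

/-- The input has been read up to the digits of `k`. -/
structure WordRead {σ : ℕ} (w : List (Fin σ)) (ds : List ℕ) (s : State) : Prop where
  len : s.v .len = w.length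
  sig : s.v .sig = σ
  inp : s.inp = ds
  out : s.out = []
  prev : ∀ j (hj : j < w.length), s.arr .prev (j + 1) = lastOcc w j w[j]
  keep : ∀ j < w.length, s.arr .keep (j + 1) = 1

/-- The array `last` holds the latest position of each letter; its entry goes into `prev` just
before it is overwritten. Setting `keep` to `1` everywhere encodes layer `0`. -/
theorem readWord_spec {σ : ℕ} {w : List (Fin σ)} {ds : List ℕ} {M : ℕ} (hσ : σ ≤ w.length)
    (hM : 30 * w.length + 100 ≤ M) :
    ∃ s' t, Exec M readWord
        (.start (w.length :: σ :: (w.map (fun a : Fin σ => (a : ℕ) + 1) ++ ds))) s' t ∧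
      WordRead w ds s' ∧ t ≤ 60 * w.length + 20 := by
  apply Cmd.exists_exec_of_wp
  simp only [readWord, Cmd.wp]
  simp [State.start]
  refine ⟨by omega, by omega, by omega, by omega, wp_loop (i := 0) (N := w.length) (fun j s t =>
    s.v .pos = j ∧ s.v .len = w.length ∧ s.v .sig = σ ∧
    s.inp = (w.drop j).map (fun a : Fin σ => (a : ℕ) + 1) ++ ds ∧
    (∀ a : Fin σ, s.arr .last (a + 1) = lastOcc w j a) ∧
    (∀ x (hx : x < w.length), x < j → s.arr .prev (x + 1) = lastOcc w x w[x]) ∧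
    (∀ x < j, s.arr .keep (x + 1) = 1) ∧ s.out = [] ∧ t ≤ 60 * j) ?_ (Nat.zero_le _) ?_ ?_⟩
  · simp [lastOcc]
  · rintro j s t hj ⟨h1, h2, h3, h4, h5, h6, h7, h8, h9⟩
    rw [List.drop_eq_getElem_cons hj, List.map_cons, List.cons_append] at h4
    have ha := w[j].isLt
    simp [h1, h2, h3, h4, h5]
    refine ⟨hj, by omega, by omega, by omega, by omega, by omega, by omega, by omega, by omega,
      by omega, by omega, by omega, ?_, ?_, ?_, h8, by omega⟩
    · intro a
      rw [lastOcc, List.getElem?_eq_getElem hj, Function.update_apply, h5]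
      simp only [Option.some.injEq, add_left_inj, Fin.val_inj, eq_comm]
    · intro x hx hxj
      rw [Function.update_apply]
      split_ifs with hc
      · obtain rfl : x = j := by omega
        rfl
      · exact h6 x hx (by omega)
    · intro x hx
      rw [Function.update_apply]
      split_ifs with hc
      · rfl
      · exact h7 x (by omega)
  · rintro s t ⟨h1, h2, h3, h4, h5, h6, h7, h8, h9⟩
    refine ⟨by simp [h1, h2], ⟨h2, h3, by simpa using h4, h8, fun j hj => h6 j hj hj, h7⟩, ?_⟩
    simp
    omega

/-- Read the first digit of `k`, and the second one if there is one. -/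
def readLimbs : Cmd := .read .limb .flag ;; .read .next .flag

theorem readLimbs_spec {M d : ℕ} {ds : List ℕ} {s : State} (hs : s.inp = d :: ds)
    (hM : 1 < M) (hd : d < M) (hds : ∀ x ∈ ds, x < M) :
    ∃ s' t, Exec M readLimbs s s' t ∧ s'.v .limb = d ∧
      s'.v .flag = (if 0 < ds.length then 1 else 0) ∧ (∀ h : 0 < ds.length, s'.v .next = ds[0]) ∧
      s'.inp = ds.drop 1 ∧ s'.out = s.out ∧ t ≤ 6 := by
  apply Cmd.exists_exec_of_wp
  simp [readLimbs, hs]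
  refine ⟨hd, hM, ?_, ?_⟩
  · rintro a l rfl
    simp [hM, hds]
  · rintro rfl
    simp

/-- Compute the length of the blocks and their number. -/
def computeBase : Cmd :=
  .assign .base (.lit 1) ;; .assign .width (.lit 0) ;;
  .loop (.var .base) (.bin .add (.var .len) (.lit 1))
    (.assign .base (.bin .add (.var .base) (.var .base)) ;; .incr .width) ;;
  .assign .blocks (.bin .add (.bin .div (.var .len) (.var .width)) (.lit 1))

theorem computeBase_spec {M n : ℕ} {s : State} (hs : s.v .len = n)
    (hM : 30 * 2 ^ Nat.size n + 100 ≤ M) :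
    ∃ s' t, Exec M computeBase s s' t ∧ s'.v .base = 2 ^ Nat.size n ∧
      s'.v .width = Nat.size n ∧ s'.v .blocks = n / Nat.size n + 1 ∧ t ≤ 40 * n + 40 := by
  have hn := lt_two_pow_size n
  have hn' := size_le_self n
  apply Cmd.exists_exec_of_wp
  simp only [computeBase, Cmd.wp]
  refine ⟨by simp; omega, by simp; omega, wp_loop (i := 0) (N := Nat.size n) (fun i σ t =>
    σ.v .base = 2 ^ i ∧ σ.v .width = i ∧ σ.v .len = n ∧ t ≤ 40 * i) ?_ (Nat.zero_le _) ?_ ?_⟩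
  · simp [hs]
  · rintro i σ t hi ⟨h1, h2, h3, h4⟩
    have h5 := Nat.lt_size.1 hi
    simp [h1, h2, h3]
    refine ⟨by omega, by omega, by omega, by omega, by rw [pow_succ]; omega, by omega⟩
  · rintro σ t ⟨h1, h2, h3, h4⟩
    simp [h1, h2, h3]
    have := Nat.div_le_self n (Nat.size n)
    refine ⟨⟨by omega, by omega⟩, by omega, by omega⟩

/-! ### The dynamic program -/

/-- Tabulate the positions of the leading bits. -/
def msbTable : Cmd :=
  .assign .idx (.lit 2) ;;
  .loop (.var .idx) (.var .base)
    (.put .msb (.var .idx) (.bin .add (.get .msb (.bin .div (.var .idx) (.lit 2))) (.lit 1)) ;;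
      .incr .idx)

/-- Halving lowers the logarithm by one. The entries `0` and `1` are correct from the start, since
`Nat.log 2` vanishes there. -/
theorem msbTable_spec {M : ℕ} {s : State} (h0 : s.arr .msb = fun _ => 0) (hb : 2 ≤ s.v .base)
    (hM : 30 * s.v .base + 100 ≤ M) :
    ∃ s' t, Exec M msbTable s s' t ∧ (∀ x < s.v .base, s'.arr .msb x = Nat.log 2 x) ∧
      t ≤ 30 * s.v .base := by
  apply Cmd.exists_exec_of_wp
  simp only [msbTable, Cmd.wp]
  refine ⟨by simp; omega, wp_loop (i := 2) (N := s.v .base) (fun i σ t =>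
    σ.v .base = s.v .base ∧ σ.v .idx = i ∧ 2 ≤ i ∧ (∀ x < i, σ.arr .msb x = Nat.log 2 x) ∧
    -- The loop starts at `i = 2`; the slack of `60` pays for the initial assignment and the last
    -- test.
    t + 60 ≤ 30 * i) ?_ hb ?_ ?_⟩
  · simp [h0]
    intro x hx
    interval_cases x <;> simp
  · rintro i σ t hi ⟨h1, h2, h3, h4, h5⟩
    have h6 : Nat.log 2 i = Nat.log 2 (i / 2) + 1 := Nat.log_of_one_lt_of_le (by norm_num) h3
    have h7 := Nat.log_lt_self 2 (x := i / 2) (by omega)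
    simp [h1, h2, h4 (i / 2) (by omega)]
    refine ⟨hi, ⟨by omega, by omega, by omega⟩, by omega, by omega, by omega, ?_, by omega⟩
    intro x hx
    rw [Function.update_apply]
    split_ifs with hc
    · rw [hc, h6, Nat.add_sub_cancel]
    · exact h4 x (by omega)
  · rintro σ t ⟨h1, h2, h3, h4, h5⟩
    refine ⟨by simp [h1, h2], h4, ?_⟩
    simp
    omega

/-- The layers of the dynamic program. -/
def layers : Cmd := .loop (.var .round) (.var .limb) (layer ;; .incr .round)

theorem layers_spec {σ : ℕ} {w : List (Fin σ)} {M k : ℕ} {s : State} (henv : Env w s)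
    (hw : 0 < w.length) (hM : 1000 * 2 ^ Nat.size w.length ≤ M) (hkM : k < M)
    (hk : s.v .limb = k) (h0 : s.v .round = 0)
    (hkeep : ∀ x < w.length, s.arr .keep (x + 1) = 1) :
    ∃ s' t, Exec M layers s s' t ∧ Env w s' ∧
      (∀ x < w.length, KeepOk w k x (s'.arr .keep (x + 1))) ∧
      t ≤ k * (1000 * w.length + 20) + 4 := by
  apply Cmd.exists_exec_of_wp
  refine wp_loop (i := 0) (N := k) (fun i σ t => Env w σ ∧ σ.v .round = i ∧ σ.v .limb = k ∧
    (∀ x < w.length, KeepOk w i x (σ.arr .keep (x + 1))) ∧ t ≤ i * (1000 * w.length + 20))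
    ?_ (Nat.zero_le _) ?_ ?_
  · refine ⟨henv, h0, hk, fun x hx => ?_, by omega⟩
    -- `bestSum w 0` is constantly `0`, so in layer `0` no position brings growth.
    rw [hkeep x hx]
    exact ⟨rfl, le_rfl⟩
  · rintro i s t hi ⟨h1, h2, h3, h4, h5⟩
    obtain ⟨s', t', hx, h6, h7, h8⟩ := layer_spec h1 hw hM h4
    have a1 : s'.v .round = i := by rw [hx.var_eq (by decide), h2]
    have a2 : s'.v .limb = k := by rw [hx.var_eq (by decide), h3]
    refine ⟨trivial, trivial, by simp [h2, h3, hi], ?_⟩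
    rw [Cmd.wp]
    refine hx.wp ?_
    have x2 : Exec M (.incr .round) s' _ _ := .assign (M := M) (s := s') (x := .round)
      (e := .bin .add (.var .round) (.lit 1)) (by simp [a1]; omega)
    refine x2.wp ⟨h6.frame x2 (by decide), by simp [a1], by simp [a2], h7, ?_⟩
    rw [add_mul]
    simp
    omega
  · rintro s t ⟨h1, h2, h3, h4, h5⟩
    refine ⟨by simp [h2, h3], h1, h4, ?_⟩
    simp
    omega

/-- Count the marked positions. -/
def countKeep : Cmd :=
  .assign .pos (.lit 0) ;;
  .loop (.var .pos) (.var .len)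
    (.assign .carry (.bin .add (.var .carry)
        (.get .keep (.bin .add (.var .pos) (.lit 1)))) ;; .incr .pos)

/-- The marks are the defects of growth, so their sum is `n - bestSum w k n`. It is left in `carry`,
where the multiplication begins. -/
theorem countKeep_spec {σ : ℕ} {w : List (Fin σ)} {M k : ℕ} {s : State}
    (hlen : s.v .len = w.length) (hM : 30 * w.length + 100 ≤ M) (h0 : s.v .carry = 0)
    (hkeep : ∀ x < w.length, KeepOk w k x (s.arr .keep (x + 1))) :
    ∃ s' t, Exec M countKeep s s' t ∧ s'.v .carry + bestSum w k w.length = w.length ∧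
      t ≤ 40 * w.length + 10 := by
  apply Cmd.exists_exec_of_wp
  simp only [countKeep, Cmd.wp]
  refine ⟨by simp; omega, wp_loop (i := 0) (N := w.length) (fun i σ t => σ.v .pos = i ∧
    σ.v .len = w.length ∧ σ.arr .keep = s.arr .keep ∧ σ.v .carry + bestSum w k i = i ∧
    t ≤ 40 * i) ?_ (Nat.zero_le _) ?_ ?_⟩
  · simp [h0, hlen, bestSum_zero_right]
  · rintro i σ t hi ⟨h1, h2, h3, h4, h5⟩
    obtain ⟨h6, h7⟩ := hkeep i hi
    simp [h1, h2, h3]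
    refine ⟨by omega, by omega, by omega, by omega, by omega⟩
  · rintro σ t ⟨h1, h2, h3, h4, h5⟩
    refine ⟨by simp [h1, h2], h4, ?_⟩
    simp
    omega

/-- The dynamic program, run for numbers `k` with one digit and at most the length of the word. -/
def dynamicProgram : Cmd :=
  .cond (.var .flag) (.lit 1)
    (.cond (.var .limb) (.bin .add (.var .len) (.lit 1)) (msbTable ;; layers ;; countKeep) .skip)
    .skip

theorem two_pow_size_le {n : ℕ} (hn : 0 < n) : 2 ^ Nat.size n ≤ 2 * n := by
  have h := Nat.size_pos.2 hn
  have h1 : 2 ^ (Nat.size n - 1) ≤ n := Nat.lt_size.1 (by omega)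
  have h2 : 2 ^ Nat.size n = 2 * 2 ^ (Nat.size n - 1) := by
    rw [← pow_succ']
    congr 1
    omega
  omega

theorem dynamicProgram_spec_of_le {σ : ℕ} {w : List (Fin σ)} {M k : ℕ} {s : State}
    (hw : 0 < w.length) (hM : 1000 * 2 ^ Nat.size w.length ≤ M)
    (hlen : s.v .len = w.length) (hwidth : s.v .width = Nat.size w.length)
    (hbase : s.v .base = 2 ^ Nat.size w.length)
    (hblocks : s.v .blocks = w.length / Nat.size w.length + 1)
    (hprev : ∀ j (hj : j < w.length), s.arr .prev (j + 1) = lastOcc w j w[j])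
    (hmsb : s.arr .msb = fun _ => 0) (hkeep : ∀ x < w.length, s.arr .keep (x + 1) = 1)
    (hround : s.v .round = 0) (hcarry : s.v .carry = 0) (hlimb : s.v .limb = k)
    (hk0 : 0 < k) (hk : k ≤ w.length) (hflag : s.v .flag = 0) :
    ∃ s' t, Exec M dynamicProgram s s' t ∧ s'.v .carry + bestSum w k w.length = w.length ∧
      t ≤ 1500 * (w.length * k) := by
  have hn := lt_two_pow_size w.length
  have hn' := two_pow_size_le hw
  obtain ⟨s1, t1, x1, h1, h1'⟩ := msbTable_spec (M := M) (s := s) hmsb (by omega) (by omega)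
  have henv : Env w s1 := by
    constructor
    · rw [x1.var_eq (by decide), hlen]
    · rw [x1.var_eq (by decide), hwidth]
    · rw [x1.var_eq (by decide), hbase]
    · rw [x1.var_eq (by decide), hblocks]
    · rw [x1.arr_eq (by decide)]; exact hprev
    · rw [← hbase]; exact h1
  obtain ⟨s2, t2, x2, h2, h2', h2''⟩ := layers_spec henv hw hM (k := k) (by omega)
    (by rw [x1.var_eq (by decide), hlimb]) (by rw [x1.var_eq (by decide), hround])
    (by rw [x1.arr_eq (by decide)]; exact hkeep)
  obtain ⟨s3, t3, x3, h3, h3'⟩ := countKeep_spec (M := M) h2.len (by omega)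
    (by rw [x2.var_eq (by decide), x1.var_eq (by decide), hcarry]) h2'
  apply Cmd.exists_exec_of_wp
  rw [dynamicProgram, Cmd.wp, Cmd.wp]
  refine ⟨trivial, by simp; omega, fun _ => ⟨trivial, by simp [hlen]; omega, fun _ =>
    (Exec.seq x1 (.seq x2 x3)).wp ⟨h3, ?_⟩, fun h => ?_⟩, fun h => ?_⟩
  · have e1 : w.length ≤ w.length * k := Nat.le_mul_of_pos_right _ hk0
    have e2 : k ≤ w.length * k := Nat.le_mul_of_pos_left _ hw
    have e3 : k * (1000 * w.length + 20) = 1000 * (w.length * k) + 20 * k := by ring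
    simp
    omega
  · simp [hlen, hlimb] at h
    omega
  · simp [hflag] at h

theorem dynamicProgram_spec_of_lt {M : ℕ} {s : State} (hM : s.v .len + 10 ≤ M)
    (h : s.v .flag = 0 → s.v .len < s.v .limb) :
    ∃ t, Exec M dynamicProgram s s t ∧ t ≤ 20 := by
  suffices hw : dynamicProgram.wp M (fun s' t => s' = s ∧ t ≤ 20) s by
    obtain ⟨s', t, hx, rfl, ht⟩ := Cmd.exists_exec_of_wp hw
    exact ⟨t, hx, ht⟩
  rw [dynamicProgram, Cmd.wp, Cmd.wp]
  refine ⟨trivial, by simp; omega, fun h1 => ⟨trivial, by simp; omega, fun h2 => ?_, fun _ => ?_⟩,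
    fun _ => ?_⟩
  · simp at h1 h2
    have := h h1
    omega
  · simp
  · simp

end WordRAM

namespace WordRAM

open Words

/-! ### Writing the result -/

/-- Multiply a digit by the size of the alphabet and write the next digit of the result; the
carry is kept `len` too large, so that it stays nonnegative. -/
def emitLimb (x : Var) : Cmd :=
  .assign .acc (.bin .add (.bin .add (.bin .mul (.var x) (.var .sig)) (.var .carry))
    (.bin .sub (.bin .mul (.var .len) (.var .base)) (.var .len))) ;;
  .write (.bin .mod (.var .acc) (.var .base)) ;;
  .assign .carry (.bin .div (.var .acc) (.var .base))

/-- The result has been written as far as it depends on the digits `ds`. -/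
structure Emitted (n σ u B : ℕ) (ds : List ℕ) (s : State) : Prop where
  len : s.v .len = n
  sig : s.v .sig = σ
  base : s.v .base = B
  length : s.out.length = ds.length
  lt : ∀ x ∈ s.out, x < B
  val : Nat.ofDigits B s.out + B ^ ds.length * s.v .carry + n =
    Nat.ofDigits B ds * σ + u + n * B ^ ds.length
  carry_le : s.v .carry ≤ 2 * n + 3

/-- Long multiplication computing `kσ + u - n`, whose true carry `carry - n` may be negative. Adding
`nB - n` turns `dσ + carry` into the true sum plus `nB`, so division by `B` restores the offset `n`
and the remainder is the correct digit. -/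
theorem emitLimb_spec {n σ u B d M : ℕ} {ds : List ℕ} {s : State} {x : Var}
    (h : Emitted n σ u B ds s) (hσ : σ ≤ n) (hn : n < B) (hd : d < B) (hxd : s.v x = d)
    (hM : 100 * (B * B) ≤ M) :
    ∃ s' t, Exec M (emitLimb x) s s' t ∧ Emitted n σ u B (ds ++ [d]) s' ∧ s'.inp = s.inp ∧
      t ≤ 30 := by
  obtain ⟨h1, h2, h3, h4, h5, h6, h7⟩ := h
  have hB : 0 < B := by omega
  have e1 : d * σ ≤ (B - 1) * n := Nat.mul_le_mul (by omega) hσ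
  have e2 : (B - 1) * n + n = n * B := by
    obtain ⟨b, rfl⟩ : ∃ b, B = b + 1 := ⟨B - 1, by omega⟩
    simp; ring
  have e3 : n * B ≤ B * B := Nat.mul_le_mul_right _ hn.le
  have e4 : B ≤ B * B := Nat.le_mul_of_pos_left _ hB
  have e5 : n ≤ n * B := Nat.le_mul_of_pos_right _ hB
  set a := d * σ + s.v .carry + (n * B - n) with ha
  have hle : a ≤ (2 * n + 3) * B := by
    have e6 : (2 * n + 3) * B = 2 * (n * B) + 3 * B := by ring
    omega
  have hdiv : a / B ≤ 2 * n + 3 := Nat.div_le_of_le_mul (by rwa [mul_comm] at hle)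
  have hmod : a % B < B := Nat.mod_lt _ hB
  have hdm : B * (a / B) + a % B = a := Nat.div_add_mod a B
  apply Cmd.exists_exec_of_wp
  simp [emitLimb, h1, h2, h3, hxd, ← ha]
  refine ⟨by omega, by omega, by omega, by simp [h1], by simp [h2], by simp [h3], by simp [h4],
    ?_, ?_, by simpa using hdiv⟩
  · intro y hy
    simp only [State.setVar_out, List.mem_append, List.mem_singleton] at hy
    rcases hy with hy | rfl
    · exact h5 y hy
    · exact hmod
  · simp only [State.setVar_out, State.setVar_v, if_true, List.length_append, List.length_singleton,
      Nat.ofDigits_append, Nat.ofDigits_singleton, h4]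
    have e7 : B ^ (ds.length + 1) * (a / B) + B ^ ds.length * (a % B) = B ^ ds.length * a := by
      rw [pow_succ]
      conv_rhs => rw [← hdm]
      ring
    have e8 : a + n = d * σ + s.v .carry + n * B := by omega
    have e9 : B ^ ds.length * (a + n) = B ^ ds.length * (d * σ + s.v .carry + n * B) := by rw [e8]
    simp only [mul_add] at e9
    rw [pow_succ] at e7 ⊢
    linarith

/-- Multiply the digits of `k` by the size of the alphabet and write the result. -/
def output : Cmd :=
  emitLimb .limb ;;
  .loop (.lit 0) (.var .flag) (emitLimb .next ;; .read .next .flag) ;;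
  .write (.bin .sub (.var .carry) (.var .len))

theorem output_spec {n σ u B d M : ℕ} {ds : List ℕ} {s : State}
    (h : Emitted n σ u B [] s) (hσ0 : 0 < σ) (hσ : σ ≤ n) (hn : n < B) (hd : d < B)
    (hds : ∀ x ∈ ds, x < B) (hu : u ≤ n) (hle : n ≤ Nat.ofDigits B (d :: ds) * σ + u)
    (hlimb : s.v .limb = d) (hflag : s.v .flag = if 0 < ds.length then 1 else 0)
    (hnext : ∀ h : 0 < ds.length, s.v .next = ds[0]) (hinp : s.inp = ds.drop 1)
    (hM : 100 * (B * B) ≤ M) :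
    ∃ s' t, Exec M output s s' t ∧ (∀ x ∈ s'.out, x < B) ∧
      Nat.ofDigits B s'.out = Nat.ofDigits B (d :: ds) * σ + u - n ∧
      t ≤ 60 * ds.length + 60 := by
  have hB : B ≤ B * B := Nat.le_mul_of_pos_left _ (by omega)
  obtain ⟨s1, t1, x1, E1, i1, ht1⟩ := emitLimb_spec h hσ hn hd hlimb hM
  have hwp : (Cmd.loop (.lit 0) (.var .flag) (emitLimb .next ;; .read .next .flag)).wp M
      (fun s' t => Emitted n σ u B (d :: ds) s' ∧ t ≤ 60 * ds.length + 10) s1 := by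
    refine wp_loop (i := 0) (N := ds.length) (fun i σ' t => Emitted n σ u B (d :: ds.take i) σ' ∧
      σ'.v .flag = (if i < ds.length then 1 else 0) ∧
      (∀ h : i < ds.length, σ'.v .next = ds[i]) ∧ σ'.inp = ds.drop (i + 1) ∧ t ≤ 60 * i)
      ?_ (Nat.zero_le _) ?_ ?_
    · refine ⟨by simpa using E1, ?_, ?_, by rw [i1, hinp], by omega⟩
      · rw [x1.var_eq (by decide), hflag]
      · intro h0; rw [x1.var_eq (by decide), hnext h0]
    · rintro i s2 t hi ⟨g1, g2, g3, g4, g5⟩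
      have hdi := hds _ (List.getElem_mem hi)
      obtain ⟨s3, t3, x3, E3, i3, ht3⟩ := emitLimb_spec (x := .next) g1 hσ hn
        hdi (g3 hi) hM
      rw [List.cons_append, ← List.take_succ_eq_append_getElem hi] at E3
      refine ⟨by simp; omega, trivial, by simp [g2, hi], ?_⟩
      rw [Cmd.wp]
      refine x3.wp ?_
      rw [Cmd.wp, i3, g4]
      refine ⟨?_, ?_⟩
      · intro a l hal
        have hi' : i + 1 < ds.length := by
          by_contra hc
          rw [List.drop_eq_nil_of_le (by omega)] at hal
          simp at hal
        rw [List.drop_eq_getElem_cons hi', List.cons.injEq] at hal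
        obtain ⟨rfl, rfl⟩ := hal
        have := hds _ (List.getElem_mem hi')
        refine ⟨by omega, by omega, ?_, by simp [hi'], by simp, rfl, by simp; omega⟩
        obtain ⟨a1, a2, a3, a4, a5, a6, a7⟩ := E3
        exact ⟨by simpa using a1, by simpa using a2, by simpa using a3, a4, a5, by simpa using a6,
          by simpa using a7⟩
      · intro hal
        have hi' : ds.length ≤ i + 1 := by simpa using hal
        refine ⟨?_, by simp; omega, by intro h; omega, ?_, by simp; omega⟩
        · obtain ⟨a1, a2, a3, a4, a5, a6, a7⟩ := E3
          exact ⟨by simpa using a1, by simpa using a2, by simpa using a3, a4, a5,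
            by simpa using a6, by simpa using a7⟩
        · rw [State.setVar_inp, i3, g4, hal, List.drop_eq_nil_of_le (by omega)]
    · rintro s2 t ⟨g1, g2, g3, g4, g5⟩
      rw [List.take_length] at g1
      refine ⟨⟨by simp; omega, trivial, by simp [g2]⟩, g1, by simp; omega⟩
  obtain ⟨s2, t2, x2, E2, ht2⟩ := Cmd.exists_exec_of_wp hwp
  obtain ⟨a1, a2, a3, a4, a5, a6, a7⟩ := E2
  have hlt1 : Nat.ofDigits B s2.out < B ^ (d :: ds).length := by
    rw [← a4]
    exact Nat.ofDigits_lt_base_pow_length (by omega) a5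
  have hlt2 : Nat.ofDigits B (d :: ds) < B ^ (d :: ds).length :=
    Nat.ofDigits_lt_base_pow_length (by omega) (by simpa using ⟨hd, hds⟩)
  set K := Nat.ofDigits B (d :: ds) with hK
  set P := B ^ (d :: ds).length with hP
  -- The whole result is nonnegative and the written digits stay below `P`, so the true final carry
  -- cannot be negative.
  have hge : n ≤ s2.v .carry := by
    by_contra hc
    have h1 : P * (s2.v .carry + 1) ≤ P * n := Nat.mul_le_mul_left _ (by omega)
    rw [mul_add, mul_comm P n] at h1
    omega
  obtain ⟨r, hr⟩ := Nat.exists_eq_add_of_le hge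
  have hval : Nat.ofDigits B s2.out + P * r = K * σ + u - n := by
    rw [hr, mul_add, mul_comm P n] at a6
    omega
  -- `P * r ≤ Kσ < Pσ` since `u ≤ n`; hence `r < σ ≤ n < B`, and one last digit suffices.
  have hrB : r < B := by
    have h1 : K * σ < P * σ := Nat.mul_lt_mul_of_pos_right hlt2 hσ0
    by_contra hc
    have h2 : P * σ ≤ P * r := Nat.mul_le_mul_left _ (by omega)
    rw [mul_comm P σ, mul_comm σ P] at h2
    omega
  have x3 : Exec M (.write (.bin .sub (.var .carry) (.var .len))) s2 _ _ :=
    .write (M := M) (s := s2) (e := .bin .sub (.var .carry) (.var .len))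
      (by simp [a1, hr]; omega)
  refine ⟨_, _, .seq x1 (.seq x2 x3), ?_, ?_, by simp; omega⟩
  · intro y hy
    simp only [Expr.val, Op.eval, a1, hr, List.mem_append, List.mem_singleton] at hy
    rcases hy with hy | rfl
    · exact a5 y hy
    · omega
  · simp only [Expr.val, Op.eval, a1, hr, Nat.add_sub_cancel_left, Nat.ofDigits_append,
      Nat.ofDigits_singleton, a4]
    exact hval

/-! ### The whole program -/

def insertionProgram : Cmd :=
  readWord ;; readLimbs ;; computeBase ;; dynamicProgram ;; output

/-- In the elaborated `wordInput` the whole list is coerced to `List ℕ` by `>>=` before the map;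
here this becomes a letterwise coercion. -/
theorem wordInput_eq {σ : ℕ} (w : List (Fin σ)) (k : ℕ) : wordInput w k = w.length :: σ ::
    (w.map (fun a : Fin σ => (a : ℕ) + 1) ++ Nat.digits (limbBase w.length) k) := by
  have h : (w >>= fun a => pure (a : ℕ)) = w.map fun a : Fin σ => (a : ℕ) := by
    induction w with
    | nil => rfl
    | cons a w ih => simp_all
  rw [wordInput, h, List.map_map]
  rfl

/-- The number that the program writes. -/
def insertionCount {σ : ℕ} (w : List (Fin σ)) (k : ℕ) : ℕ :=
  if k ≤ w.length then k * σ - bestSum w k w.length else k * σ - w.length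

theorem isMinInsertions_insertionCount {σ : ℕ} (hσ : 0 < σ) (w : List (Fin σ)) {k : ℕ}
    (hk : 0 < k) : IsMinInsertions k w (insertionCount w k) := by
  have : Nonempty (Fin σ) := ⟨⟨0, hσ⟩⟩
  unfold insertionCount
  split_ifs with h
  · simpa using isMinInsertions_bestSum hk w
  · simpa using isMinInsertions_of_length_le (w := w) hk (by omega)

/-- Both cases share the output `kσ + u - n`: with `u = n - bestSum w k n` after the dynamic
program, and with `u = 0` when `k > n` and it is skipped. -/
theorem insertionProgram_spec {σ : ℕ} (hσ0 : 0 < σ) {w : List (Fin σ)} (hσ : σ ≤ w.length) {k : ℕ}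
    (hk : 0 < k) {M : ℕ} (hM : 1000 * (limbBase w.length * limbBase w.length) ≤ M) :
    ∃ s t, Exec M insertionProgram (.start (wordInput w k)) s t ∧
      (∀ x ∈ s.out, x < limbBase w.length) ∧
      Nat.ofDigits (limbBase w.length) s.out = insertionCount w k ∧
      t ≤ 300 * w.length + 60 * (Nat.digits (limbBase w.length) k).length +
        1500 * (if k ≤ w.length then w.length * k else 0) := by
  have : Nonempty (Fin σ) := ⟨⟨0, hσ0⟩⟩
  set n := w.length with hn
  set B := limbBase n with hB
  have hnB : n < B := lt_two_pow_size n
  have hBB : B ≤ B * B := Nat.le_mul_of_pos_left _ (by omega)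
  have hBB' : 2 * B ≤ B * B := Nat.mul_le_mul_right _ (by omega)
  obtain ⟨d, ds, hdig⟩ : ∃ d ds, Nat.digits B k = d :: ds :=
    List.exists_cons_of_ne_nil (Nat.digits_ne_nil_iff_ne_zero.2 hk.ne')
  have hlt : ∀ x ∈ d :: ds, x < B := fun x hx => Nat.digits_lt_base (by omega) (hdig ▸ hx)
  have hd : d < B := hlt d (by simp)
  have hds : ∀ x ∈ ds, x < B := fun x hx => hlt x (by simp [hx])
  have hkd : Nat.ofDigits B (d :: ds) = k := by rw [← hdig, Nat.ofDigits_digits]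
  rw [wordInput_eq, ← hB, hdig]
  obtain ⟨s1, t1, x1, W1, ht1⟩ := readWord_spec (M := M) (ds := d :: ds) hσ (by omega)
  obtain ⟨s2, t2, x2, l2, f2, n2, i2, o2, ht2⟩ := readLimbs_spec (M := M) W1.inp (by omega)
    (by omega) (fun x hx => (hds x hx).trans (by omega))
  have len2 : s2.v .len = n := by rw [x2.var_eq (by decide), W1.len]
  obtain ⟨s3, t3, x3, b3, w3, m3, ht3⟩ := computeBase_spec (M := M) len2
    (by change 30 * B + 100 ≤ M; omega)
  have len3 : s3.v .len = n := by rw [x3.var_eq (by decide), len2]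
  have limb3 : s3.v .limb = d := by rw [x3.var_eq (by decide), l2]
  have flag3 : s3.v .flag = if 0 < ds.length then 1 else 0 := by rw [x3.var_eq (by decide), f2]
  have carry3 : s3.v .carry = 0 := by
    rw [x3.var_eq (by decide), x2.var_eq (by decide), x1.var_eq (by decide)]; rfl
  obtain ⟨s4, t4, x4, u, hu, c4, v4, ht4⟩ : ∃ s4 t4, Exec M dynamicProgram s3 s4 t4 ∧ ∃ u, u ≤ n ∧
      s4.v .carry = u ∧ (n ≤ k * σ + u ∧ k * σ + u - n = insertionCount w k) ∧
      t4 ≤ 1500 * (if k ≤ n then n * k else 0) + 20 := by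
    unfold insertionCount
    rw [← hn]
    by_cases hkn : k ≤ n
    -- `k ≤ n < B`, so `k` has a single digit, which serves as the number of layers.
    · rw [Nat.digits_of_lt B k hk.ne' (by omega), List.cons.injEq] at hdig
      obtain ⟨rfl, rfl⟩ := hdig
      obtain ⟨s4, t4, x4, c4, ht4⟩ := dynamicProgram_spec_of_le (M := M) (k := k) (w := w) (s := s3)
        (by omega) (by change 1000 * B ≤ M; omega) len3 w3 b3 m3
        (by rw [x3.arr_eq (by decide), x2.arr_eq (by decide)]; exact W1.prev)
        (by rw [x3.arr_eq (by decide), x2.arr_eq (by decide), x1.arr_eq (by decide)]; rfl)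
        (by rw [x3.arr_eq (by decide), x2.arr_eq (by decide)]; exact W1.keep)
        (by rw [x3.var_eq (by decide), x2.var_eq (by decide), x1.var_eq (by decide)]; rfl)
        carry3 limb3 hk hkn (by simpa using flag3)
      have g1 := bestSum_le_length hk w
      have g2 := bestSum_le_mul hk w
      rw [Fintype.card_fin] at g2
      rw [← hn] at g1 g2 c4 ht4
      rw [if_pos hkn, if_pos hkn]
      exact ⟨s4, t4, x4, _, by omega, rfl, by omega, by omega⟩
    · obtain ⟨t4, x4, ht4⟩ := dynamicProgram_spec_of_lt (M := M) (s := s3) (by omega) (fun hf => by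
        rw [flag3] at hf
        have : ds = [] := by
          by_contra hne
          rw [if_pos (List.length_pos_iff.2 hne)] at hf
          omega
        subst this
        simp at hkd
        omega)
      have g1 : k ≤ k * σ := Nat.le_mul_of_pos_right _ hσ0
      rw [if_neg hkn, if_neg hkn]
      exact ⟨s3, t4, x4, 0, by omega, carry3, by omega, by omega⟩
  have out4 : s4.out = [] := by
    rw [(x4.tapes_eq (by decide)).2, (x3.tapes_eq (by decide)).2, o2, W1.out]
  have E4 : Emitted n σ u B [] s4 := by
    refine ⟨?_, ?_, ?_, by simp [out4], by simp [out4], by simp [out4, c4], by omega⟩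
    · rw [x4.var_eq (by decide), len3]
    · rw [x4.var_eq (by decide), x3.var_eq (by decide), x2.var_eq (by decide), W1.sig]
    · rw [x4.var_eq (by decide), b3]; rfl
  obtain ⟨s5, t5, x5, l5, v5, ht5⟩ := output_spec (M := M) E4 hσ0 hσ hnB hd hds hu
    (by rw [hkd]; exact v4.1) (by rw [x4.var_eq (by decide), limb3])
    (by rw [x4.var_eq (by decide), flag3])
    (fun h => by rw [x4.var_eq (by decide), x3.var_eq (by decide), n2 h])
    (by rw [(x4.tapes_eq (by decide)).1, (x3.tapes_eq (by decide)).1, i2]) (by omega)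
  refine ⟨s5, _, .seq x1 (.seq x2 (.seq x3 (.seq x4 x5))), l5, by rw [v5, hkd, v4.2], ?_⟩
  rw [List.length_cons]
  omega

/-! ### Comparing the digits of `k` with the time `T` -/

theorem length_out_step_le (P : Program) (W : ℕ) (s : Config) :
    (step P W s).out.length ≤ s.out.length + 1 := by
  unfold step
  cases P[s.pc]? with
  | none => simp
  | some i =>
    cases i <;> simp [Instr.exec, Config.set, Config.jump]
    split <;> simp

theorem length_out_iterate_le (P : Program) (W t : ℕ) (s : Config) :
    ((step P W)^[t] s).out.length ≤ s.out.length + t := by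
  induction t with
  | zero => simp
  | succ t ih =>
    rw [Function.iterate_succ_apply']
    have := length_out_step_le P W ((step P W)^[t] s)
    omega

/-- In `t` steps at most `t` blocks are written, so `k - n ≤ (k - n)σ < B ^ t`. Since `n < k`, also
`k ≤ (k - n)(n + 1) ≤ (k - n)B < B ^ (t + 1)`. -/
theorem length_le_of_computesWithin {P : Program} {c n σ k t : ℕ} {input : List ℕ} (hσ : 0 < σ)
    (hn : 0 < n) (hk : n < k) (h : ComputesWithin P c n input ((k - n) * σ) t) :
    (Nat.digits (limbBase n) k).length ≤ t + 1 := by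
  obtain ⟨out, ⟨-, hout⟩, hlt, hval⟩ := h
  have hnB : n < limbBase n := lt_two_pow_size n
  have hlen : out.length ≤ t := by
    rw [← hout]
    simpa [Config.start] using length_out_iterate_le P (wordBits c n) t (.start input)
  have h1 : (k - n) * σ < limbBase n ^ t := by
    rw [← hval]
    exact (Nat.ofDigits_lt_base_pow_length (by omega) hlt).trans_le
      (Nat.pow_le_pow_right (by omega) hlen)
  have h2 : k - n ≤ (k - n) * σ := Nat.le_mul_of_pos_right _ hσ
  have h3 : n ≤ (k - n) * n := Nat.le_mul_of_pos_left _ (by omega)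
  have h4 : (k - n) * (n + 1) ≤ (k - n) * limbBase n := Nat.mul_le_mul_left _ hnB
  have h5 : (k - n) * limbBase n < limbBase n ^ t * limbBase n :=
    Nat.mul_lt_mul_of_pos_right (by omega) (by omega)
  rw [Nat.digits_length_le_iff (by omega), pow_succ]
  rw [mul_add] at h4
  omega

/-- Words of `20` blocks: two of them hold the product of two digits, and since the base is at least
`2` the other `18` absorb the constant `1000`. -/
theorem mul_limbBase_le {n : ℕ} (hn : 0 < n) :
    1000 * (limbBase n * limbBase n) ≤ 2 ^ wordBits 20 n := by
  have h : 2 ^ wordBits 20 n = limbBase n ^ 18 * (limbBase n * limbBase n) := by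
    rw [wordBits, limbBase, mul_comm 20, pow_mul]
    ring
  have h2 : 2 ^ 18 ≤ limbBase n ^ 18 :=
    Nat.pow_le_pow_left (by have : n < limbBase n := lt_two_pow_size n; omega) 18
  rw [h]
  exact Nat.mul_le_mul_right _ (le_trans (by norm_num) h2)

end WordRAM

theorem theorem4 :
    ∃ (Q : WordRAM.Program) (c C : ℕ),
      ∀ (σ : ℕ) (w : List (Fin σ)) (k : ℕ),
        w ≠ [] → (∀ a : Fin σ, a ∈ w) → Words.universalityIndex w ≤ k →
        ∃ m : ℕ, Words.IsMinInsertions k w m ∧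
          (k ≤ w.length →
            WordRAM.ComputesWithin Q c w.length (WordRAM.wordInput w k) m
              (C * (w.length * k))) ∧
          (w.length < k →
            ∀ T : ℕ → ℕ → ℕ → ℕ, WordRAM.ProductTime T →
              WordRAM.ComputesWithin Q c w.length (WordRAM.wordInput w k) m
                (C * (w.length ^ 2 + T w.length σ k))) := by
  refine ⟨WordRAM.insertionProgram.code 0, 20, 2000, fun σ w k hw hall hk => ?_⟩
  obtain ⟨a, -⟩ := List.exists_mem_of_ne_nil w hw
  have hn : 0 < w.length := List.length_pos_iff.2 hw
  have hσ0 : 0 < σ := a.pos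
  have : Nonempty (Fin σ) := ⟨a⟩
  have hσ : σ ≤ w.length := by
    have h1 : w.toFinset = Finset.univ := by ext a; simp [hall a]
    have h2 := w.toFinset_card_le
    rwa [h1, Finset.card_univ, Fintype.card_fin] at h2
  have hk0 : 0 < k := (Words.universalityIndex_pos hall).trans_le hk
  obtain ⟨s, t, hx, hlt, hval, ht⟩ :=
    WordRAM.insertionProgram_spec hσ0 hσ hk0 (WordRAM.mul_limbBase_le hn)
  have e1 : w.length ≤ w.length * k := Nat.le_mul_of_pos_right _ hk0
  refine ⟨_, WordRAM.isMinInsertions_insertionCount hσ0 w hk0, fun hkn => ?_, fun hkn T hT => ?_⟩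
  · refine ⟨s.out, hx.haltsWithin ?_, hlt, hval⟩
    have hB : w.length < WordRAM.limbBase w.length := WordRAM.lt_two_pow_size _
    rw [if_pos hkn, Nat.digits_of_lt _ k hk0.ne' (by omega), List.length_singleton] at ht
    omega
  · refine ⟨s.out, hx.haltsWithin ?_, hlt, hval⟩
    obtain ⟨P, c, hP⟩ := hT
    -- The assumed program is not run; it only bounds the number of digits of `k` by `T + 1`. The
    -- actual time is linear in `n` and `T`, below the allowed `n ^ 2 + T` up to a constant.
    have h1 := WordRAM.length_le_of_computesWithin hσ0 hn hkn (hP w.length σ k hσ0 hσ hkn)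
    have h2 : w.length ≤ w.length ^ 2 := Nat.le_self_pow (by norm_num) _
    rw [if_neg (by omega)] at ht
    omega
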